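/- Let $R$ be a commutative ring with $1$, let $q\in R$ be invertible, and let $n,k$ be natural numbers with $k\ge 1$. **Hecke algebra.** Let $s_i=(i,i+1)$ $(1\le i<n)$ be the simple reflections of $\mathfrak S_n$ and $\ell$ the length function. Let $\mathcal H=\mathcal H_n(R,q)$ be the Hecke algebra, i.e. the associative unital $R$-algebra with basis $T_w$ $(w\in\mathfrak S_n)$ such that $T_1=1$, $T_xT_y=T_{xy}$ whenever $\ell(x)+\ell(y)=\ell(xy)$, and $(T_{s_i}+1)(T_{s_i}-q)=0$. Put $\operatorname{tr}\big(\sum_w a_wT_w\big)=a_1$ and $\langle x,y\rangle=\operatorname{tr}(yx)$. Let $L_i=\sum_{1\le j<i}q^{j-i}T_{(j,i)}$ $(1\le i\le n)$ be the (pairwise commuting) Jucys–Murphy operators. **Compositions.** A composition $\lambda=(\lambda_1,\dots,\lambda_l)$ of $m$ is a finite sequence of positive integers with sum $|\lambda|=m$; if $m>0$ put $\lambda'=(\lambda_1,\dots,\lambda_{l-1})$. It corresponds to the total preorder $\preceq_\lambda$ on $\{1,\dots,m\}$ whose classes, in increasing order, are consecutive intervals of sizes $\lambda_1,\dots,\lambda_l$.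 The monomial quasi-symmetric polynomial is $$p^\lambda(X_1,\dots,X_n)=\sum_{f}\prod_{x=1}^{m}X_{f(x)},$$ where $f$ runs over the maps $\{1,\dots,m\}\to\{1,\dots,n\}$ with $x\preceq_\lambda y\iff f(x)\le f(y)$. **Increasing elements.** An element $w\in\mathfrak S_n$ is increasing of shape $\lambda$, where $|\lambda|=k$, if $w=s_{i_1}\cdots s_{i_k}$ with $1\le i_1<\dots<i_k<n$, and the preorder on $\{1,\dots,k\}$ generated by the usual order and the relations $x\sim y$ whenever $s_{i_x}$ and $s_{i_y}$ do not commute equals $\preceq_\lambda$. **Matrices.** Put $\xi=q^{-1}(q-1)^2$, $\mathfrak a(0)=1$ and $\mathfrak a(s)=(q^{s-1}+q^{s-3}+\dots+q^{1-s})\,\xi$ for $s>0$. Let $a_d(X_1,\dots,X_n)$ be the homogeneous component of degree $d$ of $\prod_{i=1}^n\sum_{s\ge 0}\mathfrak a(s)X_i^s$. For compositions $\lambda,\mu$ let $A_{\lambda,\mu}=0$ if $|\lambda|<|\mu|$, and otherwise let $A_{\lambda,\mu}$ be the coefficient of $p^\lambda$ in the expansion $$a_{|\lambda|-|\mu|}(X_1,\dots,X_N)\,p^\mu(X_1,\dots,X_N)=\sum_{\nu}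 A_{\nu,\mu}\,p^\nu(X_1,\dots,X_N),$$ where $\nu$ runs over the compositions of $|\lambda|$ with at most $N$ parts and $N$ is any integer that is at least the number of parts of $\lambda$ (the coefficient does not depend on $N$). Let $Z_{\lambda,\mu}=1$ if $\lambda=\mu$ or $\lambda=\mu'$, and $Z_{\lambda,\mu}=0$ otherwise. Let $A^{(m)}$ and $Z^{(m)}$ be the corresponding matrices indexed by the compositions of size less than $m$. Define matrices $\Xi^{(m)}$ $(m\ge 1)$, indexed by the compositions of size less than $m$, by $$\Xi^{(1)}=(1),\qquad \Xi^{(m+1)}=\begin{pmatrix}\Xi^{(m)}&0\\0&\Xi^{(m)}\end{pmatrix}Z^{(m+1)}A^{(m+1)},$$ where the first block of the block diagonal matrix is indexed by the compositions of size less than $m$, and the second block by the compositions of $m$, identified with those of size less than $m$ through $\lambda\mapsto\lambda'$. **Theorem.** Let $\lambda$ and $\mu$ be compositions of $k$ and let $w\in\mathfrak S_n$ be increasing of shape $\lambda$. Then $$\langle T_w,\;p^\mu(L_1,\dots,L_n)\rangle=\Xi^{(k)}_{\lambda',\mu'}.$$ -/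

import Mathlib

namespace HeckeJM

open Equiv

/-- The simple reflection `s_{i+1} = (i+1, i+2)` of the symmetric group on `n` letters, where the
letters `1, …, n` are represented by `0, …, n-1`. -/
def simpleRefl (n : ℕ) (i : Fin (n - 1)) : Perm (Fin n) :=
  swap ⟨i, by omega⟩ ⟨i + 1, by omega⟩

/-- The length of a permutation: the minimal number of factors in an expression as a product of
simple reflections. -/
noncomputable def len {n : ℕ} (w : Perm (Fin n)) : ℕ :=
  sInf {k | ∃ l : List (Fin (n - 1)), l.length = k ∧ (l.map (simpleRefl n)).prod = w}

/-- The defining relations of the Hecke algebra between the symbols `T_w`. -/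
inductive HeckeRel (R : Type*) [CommRing R] (q : Rˣ) (n : ℕ) :
    FreeAlgebra R (Perm (Fin n)) → FreeAlgebra R (Perm (Fin n)) → Prop
  | one : HeckeRel R q n (FreeAlgebra.ι R 1) 1
  | mul (x y : Perm (Fin n)) (h : len x + len y = len (x * y)) :
      HeckeRel R q n (FreeAlgebra.ι R x * FreeAlgebra.ι R y) (FreeAlgebra.ι R (x * y))
  | quad (i : Fin (n - 1)) :
      HeckeRel R q n
        ((FreeAlgebra.ι R (simpleRefl n i) + 1) *
          (FreeAlgebra.ι R (simpleRefl n i) - algebraMap R _ (q : R))) 0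

/-- The Hecke algebra of the symmetric group on `n` letters. -/
abbrev Hecke (R : Type*) [CommRing R] (q : Rˣ) (n : ℕ) : Type _ := RingQuot (HeckeRel R q n)

section HeckeBasis

variable {R : Type*} [CommRing R] (q : Rˣ) {n : ℕ}

/-- The element `T_w` of the Hecke algebra. -/
def T (w : Perm (Fin n)) : Hecke R q n :=
  RingQuot.mkAlgHom R (HeckeRel R q n) (FreeAlgebra.ι R w)

theorem T_one : (T q 1 : Hecke R q n) = 1 := by
  simpa [T] using RingQuot.mkAlgHom_rel R (HeckeRel.one (R := R) (q := q) (n := n))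

theorem T_mul {x y : Perm (Fin n)} (h : len x + len y = len (x * y)) :
    (T q x * T q y : Hecke R q n) = T q (x * y) := by
  simpa [T] using RingQuot.mkAlgHom_rel R (HeckeRel.mul (R := R) (q := q) x y h)

theorem T_quad (i : Fin (n - 1)) :
    (T q (simpleRefl n i) + 1) * (T q (simpleRefl n i) - algebraMap R (Hecke R q n) (q : R)) = 0 := by
  have := RingQuot.mkAlgHom_rel R (HeckeRel.quad (R := R) (q := q) (n := n) i)
  simpa only [T, map_mul, map_add, map_sub, map_one, map_zero, AlgHom.commutes] using this

/-! Facts about the length. -/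

theorem simpleRefl_mul_self (i : Fin (n - 1)) : simpleRefl n i * simpleRefl n i = 1 := by
  simp [simpleRefl]

theorem simpleRefl_inv (i : Fin (n - 1)) : (simpleRefl n i)⁻¹ = simpleRefl n i := by
  simp [simpleRefl]

/-- The first letter moved by the simple reflection. -/
abbrev lo (i : Fin (n - 1)) : Fin n := ⟨i, by omega⟩

/-- The second letter moved by the simple reflection. -/
abbrev hi (i : Fin (n - 1)) : Fin n := ⟨i + 1, by omega⟩

theorem lo_lt_hi (i : Fin (n - 1)) : lo i < hi i := by simp [Fin.lt_def]

theorem simpleRefl_lo (i : Fin (n - 1)) : simpleRefl n i (lo i) = hi i := by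
  simp [simpleRefl]

theorem simpleRefl_hi (i : Fin (n - 1)) : simpleRefl n i (hi i) = lo i := by
  simp [simpleRefl]

/-- The set of inversions of a permutation. -/
def invSet (w : Perm (Fin n)) : Finset (Fin n × Fin n) :=
  Finset.univ.filter fun p => p.1 < p.2 ∧ w p.2 < w p.1

theorem mem_invSet {w : Perm (Fin n)} {a b : Fin n} :
    (a, b) ∈ invSet w ↔ a < b ∧ w b < w a := by
  simp [invSet]

theorem invSet_one : invSet (1 : Perm (Fin n)) = ∅ := by
  ext ⟨a, b⟩
  rw [mem_invSet]
  simp only [Perm.one_apply, Finset.notMem_empty, iff_false, not_and, not_lt]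
  exact fun h => h.le

/-- `i` is not a left descent of `w`. -/
def Asc (i : Fin (n - 1)) (w : Perm (Fin n)) : Prop :=
  w⁻¹ (lo i) < w⁻¹ (hi i)

instance (i : Fin (n - 1)) (w : Perm (Fin n)) : Decidable (Asc i w) := by
  unfold Asc; infer_instance

theorem simpleRefl_apply (i : Fin (n - 1)) (x : Fin n) :
    ((simpleRefl n i x : Fin n) : ℕ) =
      if (x : ℕ) = i then (i : ℕ) + 1 else if (x : ℕ) = i + 1 then (i : ℕ) else x := by
  simp only [simpleRefl, swap_apply_def, Fin.ext_iff]
  split_ifs <;> simp_all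

theorem simpleRefl_lt {i : Fin (n - 1)} {x y : Fin n}
    (h : ¬ (x = lo i ∧ y = hi i)) (h' : ¬ (y = lo i ∧ x = hi i)) :
    simpleRefl n i x < simpleRefl n i y ↔ x < y := by
  simp only [Fin.ext_iff] at h h'
  simp only [Fin.lt_def, simpleRefl_apply]
  split_ifs <;> omega

theorem card_invSet_of_asc {i : Fin (n - 1)} {w : Perm (Fin n)} (h : Asc i w) :
    (invSet (simpleRefl n i * w)).card = (invSet w).card + 1 := by
  have hs : invSet (simpleRefl n i * w) =
      insert (w⁻¹ (lo i), w⁻¹ (hi i)) (invSet w) := by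
    ext ⟨a, b⟩
    rw [Finset.mem_insert, mem_invSet, mem_invSet, Prod.mk.injEq, Perm.eq_inv_iff_eq,
      Perm.eq_inv_iff_eq, Perm.mul_apply, Perm.mul_apply]
    unfold Asc at h
    by_cases h1 : w a = lo i ∧ w b = hi i
    · have h2 : a < b := by
        rw [← h1.1, ← h1.2] at h
        simpa using h
      rw [h1.1, h1.2, simpleRefl_lo, simpleRefl_hi]
      simp [h2]
    · by_cases h2 : w b = lo i ∧ w a = hi i
      · have h3 : b < a := by
          rw [← h2.1, ← h2.2] at h
          simpa using h
        have h4 : ¬ a < b := not_lt.2 h3.le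
        tauto
      · rw [simpleRefl_lt h2 h1]
        tauto
  rw [hs, Finset.card_insert_of_notMem]
  rw [mem_invSet]
  simp

theorem asc_simpleRefl_mul {i : Fin (n - 1)} {w : Perm (Fin n)} :
    Asc i (simpleRefl n i * w) ↔ ¬ Asc i w := by
  unfold Asc
  have hne : w⁻¹ (lo i) ≠ w⁻¹ (hi i) := by
    intro h; exact (lo_lt_hi i).ne (w⁻¹.injective h)
  rw [mul_inv_rev, Perm.mul_apply, Perm.mul_apply, simpleRefl_inv, simpleRefl_lo, simpleRefl_hi]
  constructor
  · exact fun h => h.le.not_gt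
  · exact fun h => lt_of_le_of_ne (not_lt.1 h) hne.symm

theorem card_invSet_of_not_asc {i : Fin (n - 1)} {w : Perm (Fin n)} (h : ¬ Asc i w) :
    (invSet (simpleRefl n i * w)).card + 1 = (invSet w).card := by
  rw [← card_invSet_of_asc (asc_simpleRefl_mul.2 h), ← mul_assoc, simpleRefl_mul_self, one_mul]

theorem eq_one_of_asc {w : Perm (Fin n)} (h : ∀ i, Asc i w) : w = 1 := by
  cases n with
  | zero => exact Subsingleton.elim _ _
  | succ m =>
    have hm : StrictMono (w⁻¹ : Perm (Fin (m + 1))) := by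
      rw [Fin.strictMono_iff_lt_succ]
      intro i
      exact h i
    have : (w⁻¹ : Perm (Fin (m + 1))) = 1 := by
      ext x
      have := StrictMono.range_inj (f := (w⁻¹ : Perm (Fin (m + 1)))) (g := id) hm strictMono_id
      rw [Set.range_id, (w⁻¹).surjective.range_eq] at this
      simp [this.1 rfl]
    simpa using this

theorem exists_word (w : Perm (Fin n)) : ∃ l : List (Fin (n - 1)),
    l.length = (invSet w).card ∧ (l.map (simpleRefl n)).prod = w := by
  induction hk : (invSet w).card generalizing w with
  | zero =>
    refine ⟨[], rfl, ?_⟩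
    rw [eq_one_of_asc (w := w)]
    · simp
    · intro i
      by_contra hi
      have := card_invSet_of_not_asc hi
      omega
  | succ k ih =>
    by_cases h : ∀ i, Asc i w
    · rw [eq_one_of_asc h] at hk
      exfalso
      simp [invSet_one] at hk
    · push Not at h
      obtain ⟨i, hi⟩ := h
      have := card_invSet_of_not_asc hi
      obtain ⟨l, hl, hw⟩ := ih (simpleRefl n i * w) (by omega)
      refine ⟨i :: l, by simp [hl], ?_⟩
      rw [List.map_cons, List.prod_cons, hw, ← mul_assoc, simpleRefl_mul_self, one_mul]

theorem card_invSet_word (l : List (Fin (n - 1))) :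
    (invSet (l.map (simpleRefl n)).prod).card ≤ l.length := by
  induction l with
  | nil =>
    simp [invSet_one]
  | cons i l ih =>
    rw [List.map_cons, List.prod_cons, List.length_cons]
    by_cases h : Asc i (l.map (simpleRefl n)).prod
    · rw [card_invSet_of_asc h]; omega
    · have := card_invSet_of_not_asc h; omega

theorem len_eq (w : Perm (Fin n)) : len w = (invSet w).card := by
  apply le_antisymm
  · exact Nat.sInf_le (exists_word w)
  · obtain ⟨l, hl, hw⟩ := Nat.sInf_mem (s := {k | ∃ l : List (Fin (n - 1)), l.length = k ∧
      (l.map (simpleRefl n)).prod = w}) ⟨_, exists_word w⟩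
    have := card_invSet_word l
    rw [hw, hl] at this
    exact this

theorem len_of_asc {i : Fin (n - 1)} {w : Perm (Fin n)} (h : Asc i w) :
    len (simpleRefl n i * w) = len w + 1 := by
  rw [len_eq, len_eq, card_invSet_of_asc h]

theorem len_of_not_asc {i : Fin (n - 1)} {w : Perm (Fin n)} (h : ¬ Asc i w) :
    len (simpleRefl n i * w) + 1 = len w := by
  rw [len_eq, len_eq, card_invSet_of_not_asc h]

theorem len_one : len (1 : Perm (Fin n)) = 0 := by
  have h := card_invSet_word ([] : List (Fin (n - 1)))
  simp only [List.map_nil, List.prod_nil, List.length_nil] at h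
  rw [len_eq]; omega

theorem len_simpleRefl (i : Fin (n - 1)) : len (simpleRefl n i) = 1 := by
  have h : Asc i (1 : Perm (Fin n)) := by simp [Asc]
  simpa [len_one] using len_of_asc h

theorem exists_reduced (w : Perm (Fin n)) : ∃ l : List (Fin (n - 1)),
    l.length = len w ∧ (l.map (simpleRefl n)).prod = w := by
  rw [len_eq]; exact exists_word w

/-! The regular representation, used to see that the `T_w` are linearly independent. -/

/-- Left multiplication by the generator `i` on the free module on the group. -/
noncomputable def lop (i : Fin (n - 1)) : Module.End R (Perm (Fin n) →₀ R) :=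
  Finsupp.linearCombination R fun w =>
    if Asc i w then Finsupp.single (simpleRefl n i * w) 1
    else (q : R) • Finsupp.single (simpleRefl n i * w) 1 + ((q : R) - 1) • Finsupp.single w 1

/-- Right multiplication by the generator `i` on the free module on the group. -/
noncomputable def rop (i : Fin (n - 1)) : Module.End R (Perm (Fin n) →₀ R) :=
  Finsupp.linearCombination R fun w =>
    if Asc i w⁻¹ then Finsupp.single (w * simpleRefl n i) 1
    else (q : R) • Finsupp.single (w * simpleRefl n i) 1 + ((q : R) - 1) • Finsupp.single w 1

theorem lop_single (i : Fin (n - 1)) (w : Perm (Fin n)) :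
    lop q i (Finsupp.single w (1 : R)) = if Asc i w then Finsupp.single (simpleRefl n i * w) 1
    else (q : R) • Finsupp.single (simpleRefl n i * w) 1 +
      ((q : R) - 1) • Finsupp.single w (1 : R) := by
  rw [lop, Finsupp.linearCombination_single, one_smul]

theorem rop_single (i : Fin (n - 1)) (w : Perm (Fin n)) :
    rop q i (Finsupp.single w (1 : R)) = if Asc i w⁻¹ then Finsupp.single (w * simpleRefl n i) 1
    else (q : R) • Finsupp.single (w * simpleRefl n i) 1 +
      ((q : R) - 1) • Finsupp.single w (1 : R) := by
  rw [rop, Finsupp.linearCombination_single, one_smul]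

theorem asc_mul_or (i j : Fin (n - 1)) (w : Perm (Fin n)) :
    (Asc i (w * simpleRefl n j) ↔ Asc i w) ∧ (Asc j (simpleRefl n i * w)⁻¹ ↔ Asc j w⁻¹) ∨
      simpleRefl n i * w = w * simpleRefl n j := by
  by_cases h : simpleRefl n i * w = w * simpleRefl n j
  · exact Or.inr h
  left
  have key : ∀ (i j : Fin (n - 1)) (w : Perm (Fin n)), simpleRefl n i * w ≠ w * simpleRefl n j →
      (Asc i (w * simpleRefl n j) ↔ Asc i w) := by
    intro i j w h
    unfold Asc
    rw [mul_inv_rev, Perm.mul_apply, Perm.mul_apply, simpleRefl_inv]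
    have sw : simpleRefl n i = w * swap (w⁻¹ (lo i)) (w⁻¹ (hi i)) * w⁻¹ := by
      rw [Equiv.mul_swap_eq_swap_mul]
      simp [simpleRefl]
    apply simpleRefl_lt
    · rintro ⟨h1, h2⟩
      apply h
      rw [sw, h1, h2, inv_mul_cancel_right]
      rfl
    · rintro ⟨h1, h2⟩
      apply h
      rw [sw, h1, h2, inv_mul_cancel_right, swap_comm]
      rfl
  refine ⟨key i j w h, ?_⟩
  rw [mul_inv_rev, simpleRefl_inv]
  refine key j i w⁻¹ fun h' => h ?_
  have := congrArg (fun x => w * x * w) h'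
  simp only [mul_assoc, inv_mul_cancel, mul_one, mul_inv_cancel_left] at this
  exact this.symm

theorem lop_rop_comm (i j : Fin (n - 1)) :
    (lop q i * rop q j : Module.End R (Perm (Fin n) →₀ R)) = rop q j * lop q i := by
  ext1 w
  ext1
  simp only [LinearMap.coe_comp, Function.comp_apply, Finsupp.lsingle_apply, Module.End.mul_apply]
  rw [lop_single, rop_single]
  rcases asc_mul_or i j w with ⟨h1, h2⟩ | h
  · by_cases hi : Asc i w <;> by_cases hj : Asc j w⁻¹ <;>
      simp only [hi, hj, h1, h2, if_true, if_false, map_add, map_smul, lop_single, rop_single,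
        mul_assoc] <;> module
  · have e : Asc i w ↔ Asc j w⁻¹ := by
      have h1 : w (hi j) = simpleRefl n i (w (lo j)) := by
        rw [← simpleRefl_lo, ← Perm.mul_apply, ← Perm.mul_apply, h]
      have hne : w (hi j) ≠ w (lo j) := fun h => (lo_lt_hi j).ne' (w.injective h)
      have h2 : w (lo j) = lo i ∨ w (lo j) = hi i := by
        by_contra hc
        push Not at hc
        exact hne (h1.trans (swap_apply_of_ne_of_ne hc.1 hc.2))
      unfold Asc
      rw [inv_inv]
      rcases h2 with h2 | h2
      · rw [h2, simpleRefl_lo] at h1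
        rw [h1, h2, Perm.inv_eq_iff_eq.2 h2.symm, Perm.inv_eq_iff_eq.2 h1.symm]
        simp only [lo_lt_hi]
      · rw [h2, simpleRefl_hi] at h1
        rw [h1, h2, Perm.inv_eq_iff_eq.2 h2.symm, Perm.inv_eq_iff_eq.2 h1.symm]
        simp only [(lo_lt_hi _).not_gt]
    have e1 : Asc i (w * simpleRefl n j) ↔ ¬ Asc i w := by
      rw [← h, asc_simpleRefl_mul]
    have e2 : Asc j (w * simpleRefl n j)⁻¹ ↔ ¬ Asc j w⁻¹ := by
      rw [mul_inv_rev, simpleRefl_inv, asc_simpleRefl_mul]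
    have e3 : simpleRefl n i * (w * simpleRefl n j) = w * (simpleRefl n j * simpleRefl n j) := by
      rw [← mul_assoc, h, mul_assoc]
    by_cases hi : Asc i w <;> rw [e] at hi <;>
      simp only [hi, e, e1, e2, if_true, if_false, map_add, map_smul, lop_single, rop_single,
        mul_assoc, not_true, not_false_iff, h, e3]

theorem lop_quad (i : Fin (n - 1)) :
    ((lop q i + 1) * (lop q i - algebraMap R _ (q : R)) :
      Module.End R (Perm (Fin n) →₀ R)) = 0 := by
  ext1 w
  ext1
  simp only [LinearMap.coe_comp, Function.comp_apply, Finsupp.lsingle_apply, Module.End.mul_apply,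
    LinearMap.add_apply, LinearMap.sub_apply, Module.End.one_apply, Module.algebraMap_end_apply,
    LinearMap.zero_apply]
  have e := asc_simpleRefl_mul (i := i) (w := w)
  have hw : simpleRefl n i * (simpleRefl n i * w) = w := by
    rw [← mul_assoc, simpleRefl_mul_self, one_mul]
  by_cases hi : Asc i w <;>
    simp only [hi, e, hw, if_true, if_false, map_add, map_sub, map_smul, lop_single, not_true,
      not_false_iff] <;> module

/-- The subalgebra generated by the left multiplications. -/
noncomputable def lalg : Subalgebra R (Module.End R (Perm (Fin n) →₀ R)) :=
  Algebra.adjoin R (Set.range (lop q))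

theorem lalg_comm {a : Module.End R (Perm (Fin n) →₀ R)} (ha : a ∈ lalg q) (j : Fin (n - 1)) :
    Commute a (rop q j) := by
  have : lalg q ≤ Subalgebra.centralizer R {rop q j} := by
    refine Algebra.adjoin_le ?_
    rintro _ ⟨i, rfl⟩
    rw [SetLike.mem_coe, Subalgebra.mem_centralizer_iff]
    rintro _ rfl
    exact (lop_rop_comm q i j).symm
  exact ((Subalgebra.mem_centralizer_iff R).1 (this ha) _ rfl).symm

theorem lalg_ext {a b : Module.End R (Perm (Fin n) →₀ R)} (ha : a ∈ lalg q) (hb : b ∈ lalg q)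
    (h : a (Finsupp.single 1 1) = b (Finsupp.single 1 1)) : a = b := by
  ext1 w
  ext1
  simp only [LinearMap.coe_comp, Function.comp_apply, Finsupp.lsingle_apply]
  induction hk : len w⁻¹ generalizing w with
  | zero =>
    obtain ⟨l, hl, hw⟩ := exists_reduced w⁻¹
    rw [hk, List.length_eq_zero_iff] at hl
    subst hl
    have : w = 1 := by simpa using hw.symm
    rw [this, h]
  | succ k ih =>
    obtain ⟨l, hl, hw⟩ := exists_reduced w⁻¹
    have hex : ∃ i, ¬ Asc i w⁻¹ := by
      by_contra hc
      push Not at hc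
      rw [eq_one_of_asc hc, len_one] at hk
      omega
    obtain ⟨i, hi⟩ := hex
    have h1 := len_of_not_asc hi
    have h2 := asc_simpleRefl_mul.2 hi
    have hv : (w * simpleRefl n i)⁻¹ = simpleRefl n i * w⁻¹ := by
      rw [mul_inv_rev, simpleRefl_inv]
    have h3 : rop q i (Finsupp.single (w * simpleRefl n i) (1 : R)) = Finsupp.single w 1 := by
      rw [rop_single, if_pos (hv ▸ h2), mul_assoc, simpleRefl_mul_self, mul_one]
    have h4 := ih (w * simpleRefl n i) (by rw [hv]; omega)
    rw [← h3, ← Module.End.mul_apply, ← Module.End.mul_apply, (lalg_comm q ha i).eq,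
      (lalg_comm q hb i).eq, Module.End.mul_apply, Module.End.mul_apply, h4]

theorem word_single (l : List (Fin (n - 1))) (y : Perm (Fin n))
    (h : len ((l.map (simpleRefl n)).prod * y) = l.length + len y) :
    (l.map (lop q)).prod (Finsupp.single y (1 : R)) =
      Finsupp.single ((l.map (simpleRefl n)).prod * y) 1 := by
  induction l with
  | nil => simp
  | cons i l ih =>
    simp only [List.map_cons, List.prod_cons, List.length_cons, mul_assoc] at h ⊢
    have key : ∀ l : List (Fin (n - 1)),
        len ((l.map (simpleRefl n)).prod * y) ≤ l.length + len y := by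
      intro l
      induction l with
      | nil => simp
      | cons i l ih =>
        simp only [List.map_cons, List.prod_cons, List.length_cons, mul_assoc]
        by_cases hi : Asc i ((l.map (simpleRefl n)).prod * y)
        · have := len_of_asc hi; omega
        · have := len_of_not_asc hi; omega
    have h1 := key l
    by_cases hi : Asc i ((l.map (simpleRefl n)).prod * y)
    · have h2 := len_of_asc hi
      rw [Module.End.mul_apply, ih (by omega), lop_single, if_pos hi]
    · have := len_of_not_asc hi; omega

/-- Left multiplication by `T_w` on the free module on the group. -/
noncomputable def wop (w : Perm (Fin n)) : Module.End R (Perm (Fin n) →₀ R) :=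
  ((exists_reduced w).choose.map (lop q)).prod

theorem wop_mem (w : Perm (Fin n)) : wop (R := R) q w ∈ lalg q := by
  refine Subalgebra.list_prod_mem _ fun x hx => ?_
  obtain ⟨i, -, rfl⟩ := List.mem_map.1 hx
  exact Algebra.subset_adjoin ⟨i, rfl⟩

theorem wop_single {x y : Perm (Fin n)} (h : len x + len y = len (x * y)) :
    wop q x (Finsupp.single y (1 : R)) = Finsupp.single (x * y) 1 := by
  obtain ⟨h1, h2⟩ := (exists_reduced x).choose_spec
  have := word_single (R := R) q (exists_reduced x).choose y (by rw [h1, h2, h])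
  rwa [h2] at this

theorem wop_single_one (x : Perm (Fin n)) :
    wop q x (Finsupp.single 1 (1 : R)) = Finsupp.single x 1 := by
  rw [wop_single q (by rw [len_one, mul_one, add_zero]), mul_one]

/-- The left regular representation. -/
noncomputable def regRep : Hecke R q n →ₐ[R] Module.End R (Perm (Fin n) →₀ R) :=
  RingQuot.liftAlgHom R ⟨FreeAlgebra.lift R (wop q), by
    intro a b hab
    cases hab with
    | one =>
      rw [FreeAlgebra.lift_ι_apply, map_one]
      exact lalg_ext q (wop_mem q _) (one_mem _) (by rw [wop_single_one]; rfl)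
    | mul x y h =>
      rw [map_mul, FreeAlgebra.lift_ι_apply, FreeAlgebra.lift_ι_apply, FreeAlgebra.lift_ι_apply]
      refine lalg_ext q (mul_mem (wop_mem q _) (wop_mem q _)) (wop_mem q _) ?_
      rw [Module.End.mul_apply, wop_single_one, wop_single_one, wop_single q h]
    | quad i =>
      have h : wop (R := R) q (simpleRefl n i) = lop q i := by
        refine lalg_ext q (wop_mem q _) (Algebra.subset_adjoin ⟨i, rfl⟩) ?_
        have h1 : Asc i (1 : Perm (Fin n)) := by simp [Asc]
        rw [wop_single_one, lop_single, if_pos h1, mul_one]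
      rw [map_mul, map_add, map_sub, map_one, map_zero, FreeAlgebra.lift_ι_apply,
        AlgHom.commutes, h, lop_quad]⟩

theorem regRep_T (w : Perm (Fin n)) :
    regRep q (T q w : Hecke R q n) (Finsupp.single 1 (1 : R)) = Finsupp.single w 1 := by
  rw [T, regRep, RingQuot.liftAlgHom_mkAlgHom_apply, FreeAlgebra.lift_ι_apply, wop_single_one]

theorem T_linearIndependent : LinearIndependent R (T q : Perm (Fin n) → Hecke R q n) := by
  let f : Hecke R q n →ₗ[R] (Perm (Fin n) →₀ R) :=
    (LinearMap.applyₗ (Finsupp.single 1 (1 : R))).comp (regRep q).toLinearMap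
  refine LinearIndependent.of_comp f ?_
  have : (f ∘ T q : Perm (Fin n) → (Perm (Fin n) →₀ R)) = fun w => Finsupp.single w 1 :=
    funext fun w => regRep_T q w
  rw [this]
  exact Finsupp.basisSingleOne.linearIndependent

theorem T_simpleRefl_mul_mem (i : Fin (n - 1)) (w : Perm (Fin n)) :
    (T q (simpleRefl n i) * T q w : Hecke R q n) ∈ Submodule.span R (Set.range (T q)) := by
  by_cases hi : Asc i w
  · rw [T_mul q (by rw [len_of_asc hi, len_simpleRefl, add_comm])]
    exact Submodule.subset_span ⟨_, rfl⟩
  · have h1 := len_of_not_asc hi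
    have hw : simpleRefl n i * (simpleRefl n i * w) = w := by
      rw [← mul_assoc, simpleRefl_mul_self, one_mul]
    have h2 : (T q (simpleRefl n i) * T q (simpleRefl n i * w) : Hecke R q n) = T q w := by
      rw [T_mul q (by rw [hw, len_simpleRefl]; omega), hw]
    have h3 : (T q (simpleRefl n i) * T q (simpleRefl n i) : Hecke R q n) =
        ((q : R) - 1) • T q (simpleRefl n i) + (q : R) • 1 := by
      have := T_quad (R := R) q i
      rw [Algebra.algebraMap_eq_smul_one, add_mul, mul_sub, one_mul, mul_smul_comm, mul_one] at this
      rw [← sub_eq_zero, ← this]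
      module
    rw [← h2, ← mul_assoc, h3, add_mul, smul_mul_assoc, h2, smul_mul_assoc, one_mul]
    exact add_mem (Submodule.smul_mem _ _ (Submodule.subset_span ⟨_, rfl⟩))
      (Submodule.smul_mem _ _ (Submodule.subset_span ⟨_, rfl⟩))

theorem T_word (l : List (Fin (n - 1))) (h : len (l.map (simpleRefl n)).prod = l.length) :
    T q (l.map (simpleRefl n)).prod =
      (l.map fun i => (T q (simpleRefl n i) : Hecke R q n)).prod := by
  induction l with
  | nil => simp [T_one q]
  | cons i l ih =>
    simp only [List.map_cons, List.prod_cons, List.length_cons] at h ⊢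
    have h1 : len (l.map (simpleRefl n)).prod ≤ l.length := by
      rw [len_eq]; exact card_invSet_word l
    have h2 : len (l.map (simpleRefl n)).prod = l.length := by
      by_cases hi : Asc i (l.map (simpleRefl n)).prod
      · have := len_of_asc hi; omega
      · have := len_of_not_asc hi; omega
    rw [← ih h2, T_mul]
    rw [h, h2, len_simpleRefl, add_comm]

theorem T_span : ⊤ ≤ Submodule.span R (Set.range (T q : Perm (Fin n) → Hecke R q n)) := by
  set M := Submodule.span R (Set.range (T q : Perm (Fin n) → Hecke R q n)) with hM
  have hs : ∀ (i : Fin (n - 1)) (x : Hecke R q n), x ∈ M → T q (simpleRefl n i) * x ∈ M := by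
    intro i x hx
    have : M ≤ M.comap (LinearMap.mulLeft R (T q (simpleRefl n i) : Hecke R q n)) := by
      rw [hM, Submodule.span_le]
      rintro _ ⟨w, rfl⟩
      exact T_simpleRefl_mul_mem q i w
    exact this hx
  have hT : ∀ (w : Perm (Fin n)) (x : Hecke R q n), x ∈ M → T q w * x ∈ M := by
    intro w x hx
    obtain ⟨l, hl, rfl⟩ := exists_reduced w
    rw [T_word q l hl.symm]
    clear hl
    induction l with
    | nil => simpa using hx
    | cons i l ih =>
      rw [List.map_cons, List.prod_cons, mul_assoc]
      exact hs i _ ih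
  have h1 : (1 : Hecke R q n) ∈ M := by
    rw [← T_one]; exact Submodule.subset_span ⟨_, rfl⟩
  intro x _
  obtain ⟨a, rfl⟩ := RingQuot.mkAlgHom_surjective R (HeckeRel R q n) x
  suffices h : ∀ x ∈ M, RingQuot.mkAlgHom R (HeckeRel R q n) a * x ∈ M by
    simpa using h 1 h1
  induction a using FreeAlgebra.induction with
  | grade0 r =>
    intro x hx
    rw [AlgHom.commutes, ← Algebra.smul_def]
    exact M.smul_mem _ hx
  | grade1 w => exact fun x hx => hT w x hx
  | mul a b ha hb =>
    intro x hx
    rw [map_mul, mul_assoc]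
    exact ha trivial _ (hb trivial _ hx)
  | add a b ha hb =>
    intro x hx
    rw [map_add, add_mul]
    exact add_mem (ha trivial _ hx) (hb trivial _ hx)

/-- The basis of the Hecke algebra consisting of the elements `T_w`. -/
noncomputable def heckeBasis (R : Type*) [CommRing R] (q : Rˣ) (n : ℕ) :
    Module.Basis (Perm (Fin n)) R (Hecke R q n) :=
  Module.Basis.mk (T_linearIndependent q) (T_span q)

theorem heckeBasis_apply (w : Perm (Fin n)) : heckeBasis R q n w = T q w := by
  simp [heckeBasis]

end HeckeBasis

open MvPolynomial

section Form

variable {R : Type*} [CommRing R] (q : Rˣ) {n : ℕ}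

/-- The trace `tr (∑ w, a_w T_w) = a_1` of the Hecke algebra. -/
noncomputable def heckeTrace (h : Hecke R q n) : R :=
  (heckeBasis R q n).repr h 1

theorem heckeTrace_T (w : Equiv.Perm (Fin n)) :
    heckeTrace q (T q w : Hecke R q n) = if w = 1 then 1 else 0 := by
  rw [heckeTrace, ← heckeBasis_apply, Module.Basis.repr_self, Finsupp.single_apply]

/-- The bilinear form `⟨x, y⟩ = tr (y x)` of the Hecke algebra. -/
noncomputable def heckeForm (x y : Hecke R q n) : R :=
  heckeTrace q (y * x)

/-- The Jucys-Murphy operator `L_i = ∑_{j < i} q^{j - i} T_{(j, i)}`. -/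
def jucysMurphy (R : Type*) [CommRing R] (q : Rˣ) (n : ℕ) (i : Fin n) : Hecke R q n :=
  ∑ j ∈ Finset.univ.filter (· < i),
    ((q ^ ((j : ℤ) - (i : ℤ)) : Rˣ) : R) • T q (Equiv.swap j i)

end Form

/-- The value of a polynomial in `X_1, …, X_n` at a family `x_1, …, x_n` of elements of an algebra,
where a monomial takes the value `x_1 ^ m_1 ⋯ x_n ^ m_n`. For pairwise commuting elements (such as
the Jucys-Murphy operators) this is the usual evaluation of polynomials. -/
noncomputable def evalAt {R H : Type*} [CommRing R] [Ring H] [Algebra R H] {n : ℕ} (x : Fin n → H)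
    (p : MvPolynomial (Fin n) R) : H :=
  ∑ m ∈ p.support, p.coeff m • (List.ofFn fun i => x i ^ m i).prod

/-- The total preorder on `{1, …, k}` that corresponds to a composition of `k`. -/
def compLE {k : ℕ} (c : Composition k) (x y : Fin k) : Prop :=
  c.index x ≤ c.index y

instance {k : ℕ} (c : Composition k) (x y : Fin k) : Decidable (compLE c x y) := by
  unfold compLE; infer_instance

/-- The monomial quasi-symmetric polynomial `p^c (X_1, …, X_n)`: the sum of the monomials
`∏ X_{f x}` over the maps `f` to `{1, …, n}` that preserve and reflect the order. -/
noncomputable def qsym (R : Type*) [CommRing R] {k : ℕ} (c : Composition k) (n : ℕ) :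
    MvPolynomial (Fin n) R :=
  ∑ f : Fin k → Fin n with ∀ x y, compLE c x y ↔ f x ≤ f y, ∏ x, X (f x)

section Matrices

variable {R : Type*} [CommRing R] (q : Rˣ)

/-- The element `ξ = q⁻¹ (q - 1)²`. -/
def xi : R := ((q⁻¹ : Rˣ) : R) * ((q : R) - 1) ^ 2

/-- The quantum integer `[s]_q = q^{s-1} + q^{s-3} + ⋯ + q^{1-s}`. -/
def qInt (s : ℕ) : R := ∑ i ∈ Finset.range s, ((q ^ ((s : ℤ) - 1 - 2 * (i : ℤ)) : Rˣ) : R)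

theorem qInt_mul (s : ℕ) : qInt q s * ((q : R) - ((q⁻¹ : Rˣ) : R)) =
    ((q ^ (s : ℤ) : Rˣ) : R) - ((q ^ (-(s : ℤ)) : Rˣ) : R) := by
  have h : ∀ i : ℕ, ((q ^ ((s : ℤ) - 1 - 2 * (i : ℤ)) : Rˣ) : R) * ((q : R) - ((q⁻¹ : Rˣ) : R)) =
      ((q ^ ((s : ℤ) - 2 * (i : ℤ)) : Rˣ) : R) -
        ((q ^ ((s : ℤ) - 2 * ((i + 1 : ℕ) : ℤ)) : Rˣ) : R) := by
    intro i
    rw [mul_sub, ← Units.val_mul, ← Units.val_mul, ← zpow_add_one, ← zpow_sub_one]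
    push_cast
    ring_nf
  rw [qInt, Finset.sum_mul, Finset.sum_congr rfl fun i _ => h i,
    Finset.sum_range_sub' fun i : ℕ => ((q ^ ((s : ℤ) - 2 * (i : ℤ)) : Rˣ) : R)]
  ring_nf

/-- The coefficients `a(0) = 1` and `a(s) = [s]_q ξ` for `s > 0`. -/
def aCoeff (s : ℕ) : R := if s = 0 then 1 else qInt q s * xi q

/-- The homogeneous component `a_d (X_1, …, X_n)` of degree `d` of the product over `i` of the power
series `∑ s, a(s) X_i ^ s`. -/
noncomputable def aPoly (n d : ℕ) : MvPolynomial (Fin n) R :=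
  ∑ m ∈ Finset.univ.finsuppAntidiag d, monomial m (∏ i, aCoeff q (m i))

/-- The coefficient `A_{ν, μ}` of `p^ν` in the expansion of `a_{k - l} p^μ` into monomial
quasi-symmetric polynomials, read off at the monomial `X_1 ^ ν_1 ⋯ X_m ^ ν_m` (which occurs in `p^ν`
with coefficient one and in no other `p^λ`). The expansion itself, for any number of variables,
is `aPoly_mul_qsym`. -/
noncomputable def aMul {k l : ℕ} (ν : Composition k) (μ : Composition l) : R :=
  if l ≤ k then
    (aPoly q ν.length (k - l) * qsym R μ ν.length).coeff
      (Finsupp.equivFunOnFinite.symm ν.blocksFun)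
  else 0

/-- The compositions of size less than `k`. -/
abbrev CompLT (k : ℕ) : Type := Σ i : Fin k, Composition i

/-- The composition `c' = (c_1, …, c_{l-1})` obtained from a non-empty composition
`c = (c_1, …, c_l)` of `m` by removing the last part, as a composition of size less than `k`,
where `k ≥ m`. -/
def prime {m : ℕ} (c : Composition m) (hm : 0 < m) {k : ℕ} (hk : m ≤ k) : CompLT k :=
  ⟨⟨c.blocks.dropLast.sum, by
      have hne : c.blocks ≠ [] := by
        intro h
        have := c.blocks_sum
        simp [h] at this
        omega
      have h1 := congrArg List.sum (List.dropLast_append_getLast hne)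
      have h2 := c.blocks_pos (List.getLast_mem hne)
      rw [List.sum_append, List.sum_singleton, c.blocks_sum] at h1
      omega⟩,
    ⟨c.blocks.dropLast, fun h => c.blocks_pos (List.mem_of_mem_dropLast h), rfl⟩⟩

/-- The matrix `Z`, with `Z_{α, β} = 1` if `α = β` or `α = β'`, and `0` otherwise. -/
def Zmat (R : Type*) [CommRing R] (k : ℕ) : Matrix (CompLT k) (CompLT k) R :=
  Matrix.of fun α β =>
    if α = β ∨ (β.2.blocks ≠ [] ∧ α.2.blocks = β.2.blocks.dropLast) then 1 else 0

/-- The matrix `A`. -/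
noncomputable def Amat (k : ℕ) : Matrix (CompLT k) (CompLT k) R :=
  Matrix.of fun α β => aMul q α.2 β.2

/-- The compositions of size less than `k + 1` split into those of size less than `k`, followed
by those of size `k`, and the latter correspond to those of size less than `k` by `c ↦ c'`. -/
def split (k : ℕ) (hk : 0 < k) (α : CompLT (k + 1)) : CompLT k ⊕ CompLT k :=
  if h : (α.1 : ℕ) < k then Sum.inl ⟨⟨α.1, h⟩, α.2⟩
  else Sum.inr (prime α.2 (by omega) (by omega))

/-- The block diagonal matrix `diag (M, M)` indexed by the compositions of size less
than `k + 1`. -/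
def blockDiag (k : ℕ) (hk : 0 < k) (M : Matrix (CompLT k) (CompLT k) R) :
    Matrix (CompLT (k + 1)) (CompLT (k + 1)) R :=
  (Matrix.fromBlocks M 0 0 M).submatrix (split k hk) (split k hk)

/-- The matrix `Ξ^(k)` for `k > 0`, with `Ξ^(1) = (1)` and
`Ξ^(k+1) = diag (Ξ^(k), Ξ^(k)) Z^(k+1) A^(k+1)`. The matrix for `k = 0` has no entries. -/
noncomputable def XiMat : (k : ℕ) → Matrix (CompLT k) (CompLT k) R
  | 0 => 0
  | 1 => 1
  | k + 2 => blockDiag (k + 1) k.succ_pos (XiMat (k + 1)) * Zmat R (k + 2) * Amat q (k + 2)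

end Matrices

/-- `w` is increasing of shape `c`: it is a product `s_{i_1} ⋯ s_{i_k}` with `i_1 < ⋯ < i_k`, and
the preorder on the factors that is generated by their order together with the relations
`s_{i_x} ∼ s_{i_y}` for non-commuting `s_{i_x}` and `s_{i_y}` is the preorder of the
composition `c`. -/
def IsIncreasingOfShape {n k : ℕ} (w : Equiv.Perm (Fin n)) (c : Composition k) : Prop :=
  ∃ i : Fin k → Fin (n - 1), StrictMono i ∧
    w = (List.ofFn fun x => simpleRefl n (i x)).prod ∧
    ∀ x y, compLE c x y ↔ Relation.ReflTransGen
      (fun x y => x ≤ y ∨ ¬ Commute (simpleRefl n (i x)) (simpleRefl n (i y))) x y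


open MvPolynomial

section Expansion

variable {R : Type*} [CommRing R]

theorem qsym_killCompl {k : ℕ} (c : Composition k) {m n : ℕ} {e : Fin m → Fin n}
    (he : StrictMono e) : killCompl he.injective (qsym R c n) = qsym R c m := by
  classical
  rw [qsym, qsym, map_sum]
  symm
  refine Finset.sum_of_injOn (fun f => e ∘ f) ?_ ?_ ?_ ?_
  · exact fun f _ g _ h => funext fun x => he.injective (congrFun h x)
  · intro f hf
    simp only [Finset.coe_filter, Finset.mem_univ, true_and, Set.mem_ofPred_eq] at hf ⊢
    exact fun x y => (hf x y).trans he.le_iff_le.symm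
  · intro f hf hf'
    have hx : ∃ x, f x ∉ Set.range e := by
      by_contra hc
      push Not at hc
      choose g hg using hc
      apply hf'
      refine ⟨g, ?_, funext hg⟩
      simp only [Finset.coe_filter, Finset.mem_univ, true_and, Set.mem_ofPred_eq,
        Finset.mem_filter] at hf ⊢
      intro x y
      rw [hf x y, ← hg x, ← hg y, he.le_iff_le]
    obtain ⟨x, hx⟩ := hx
    rw [map_prod]
    refine Finset.prod_eq_zero (Finset.mem_univ x) ?_
    rw [killCompl, aeval_X, dif_neg hx]
  · intro f _
    rw [map_prod]
    refine Finset.prod_congr rfl fun x _ => ?_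
    rw [Function.comp_apply, ← rename_X (R := R) e, killCompl_rename_app]

theorem coeff_aPoly (q : Rˣ) (n d : ℕ) (a : Fin n →₀ ℕ) :
    (aPoly q n d).coeff a = if ∑ i, a i = d then ∏ i, aCoeff q (a i) else 0 := by
  classical
  rw [aPoly, coeff_sum]
  simp only [coeff_monomial]
  rw [Finset.sum_ite_eq']
  simp [Finset.mem_finsuppAntidiag]

theorem aPoly_killCompl (q : Rˣ) (d : ℕ) {m n : ℕ} {e : Fin m → Fin n}
    (he : StrictMono e) : killCompl he.injective (aPoly q n d) = aPoly q m d := by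
  classical
  ext a
  rw [coeff_killCompl, coeff_aPoly, coeff_aPoly]
  have h1 : ∀ i, i ∉ Set.range e → a.mapDomain e i = 0 := fun i hi =>
    Finsupp.mapDomain_of_notMem_range _ _ hi
  have h2 : ∑ i, a.mapDomain e i = ∑ i, a i := by
    symm
    refine Finset.sum_of_injOn e he.injective.injOn (by simp) ?_ ?_
    · intro i _ hi
      exact h1 i (by simpa using hi)
    · intro i _
      rw [Finsupp.mapDomain_apply he.injective]
  have h3 : ∏ i, aCoeff q (a.mapDomain e i) = ∏ i, aCoeff q (a i) := by
    symm
    refine Finset.prod_of_injOn e he.injective.injOn (by simp) ?_ ?_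
    · intro i _ hi
      rw [h1 i (by simpa using hi), aCoeff, if_pos rfl]
    · intro i _
      rw [Finsupp.mapDomain_apply he.injective]
  rw [h2, h3]

theorem card_index_eq {k : ℕ} (c : Composition k) (j : Fin c.length) :
    (Finset.univ.filter fun x => c.index x = j).card = c.blocksFun j := by
  have : (Finset.univ.filter fun x => c.index x = j) =
      Finset.univ.map (c.embedding j).toEmbedding := by
    ext x
    simp only [Finset.mem_filter, Finset.mem_univ, true_and, Finset.mem_map,
      RelEmbedding.coe_toEmbedding]
    have := c.mem_range_embedding_iff' (j := x) (i := j)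
    rw [Set.mem_range] at this
    rw [this]
    exact eq_comm
  rw [this, Finset.card_map, Finset.card_fin]

theorem index_mono {k : ℕ} (c : Composition k) : Monotone c.index := by
  intro x y h
  by_contra hc
  rw [not_le] at hc
  have h1 : (y : ℕ) < c.sizeUpTo ((c.index y : ℕ) + 1) := c.lt_sizeUpTo_index_succ y
  have h2 := c.sizeUpTo_index_le x
  have h3 := c.monotone_sizeUpTo (Nat.succ_le_of_lt (Fin.lt_def.1 hc))
  have h4 := Fin.le_def.1 h
  simp only [Nat.succ_eq_add_one] at h3
  omega

theorem eq_of_fibres {k m : ℕ} {f g : Fin k → Fin m} (hf : Monotone f) (hg : Monotone g)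
    (h : ∀ j, (Finset.univ.filter fun x => f x = j).card =
      (Finset.univ.filter fun x => g x = j).card) : f = g := by
  classical
  have hc : ∀ (f : Fin k → Fin m) (j : Fin m), (Finset.univ.filter fun x => f x ≤ j).card =
      ∑ i ∈ Finset.Iic j, (Finset.univ.filter fun x => f x = i).card := by
    intro f j
    rw [Finset.card_eq_sum_card_fiberwise (f := f) (t := Finset.Iic j)]
    · refine Finset.sum_congr rfl fun i hi => ?_
      congr 1
      ext x
      simp only [Finset.mem_filter, Finset.mem_univ, true_and, and_iff_right_iff_imp]
      rintro rfl
      exact Finset.mem_Iic.1 hi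
    · intro x hx
      simpa using hx
  have hlow : ∀ {f : Fin k → Fin m} (_ : Monotone f) (j : Fin m),
      IsLowerSet ((Finset.univ.filter fun x => f x ≤ j : Finset (Fin k)) : Set (Fin k)) := by
    intro f hf j x y hxy hx
    simp only [Finset.coe_filter, Finset.mem_univ, true_and, Set.mem_ofPred_eq] at hx ⊢
    exact (hf hxy).trans hx
  have heq : ∀ j, (Finset.univ.filter fun x => f x ≤ j) = Finset.univ.filter fun x => g x ≤ j := by
    intro j
    have hcard : (Finset.univ.filter fun x => f x ≤ j).card =
        (Finset.univ.filter fun x => g x ≤ j).card := by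
      rw [hc, hc]; exact Finset.sum_congr rfl fun i _ => h i
    rcases (hlow hf j).total (hlow hg j) with h1 | h1
    · exact Finset.eq_of_subset_of_card_le (Finset.coe_subset.1 h1) hcard.ge
    · exact (Finset.eq_of_subset_of_card_le (Finset.coe_subset.1 h1) hcard.le).symm
  have hiff : ∀ x j, f x ≤ j ↔ g x ≤ j := fun x j => by
    have := congrArg (x ∈ ·) (heq j)
    simpa using this
  funext x
  exact le_antisymm ((hiff x _).2 le_rfl) ((hiff x _).1 le_rfl)

theorem composition_eq_of_compLE {k : ℕ} {c d : Composition k}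
    (h : ∀ x y, compLE c x y ↔ compLE d x y) : c = d := by
  have hsurj : ∀ (c : Composition k) (j : Fin c.length), ∃ x, c.index x = j := fun c j =>
    ⟨c.embedding j ⟨0, c.one_le_blocksFun j⟩, c.index_embedding _ _⟩
  choose s hs using hsurj
  have hle : ∀ i j, d.index (s c i) ≤ d.index (s c j) ↔ i ≤ j := fun i j => by
    have := h (s c i) (s c j)
    unfold compLE at this
    rw [hs, hs] at this
    exact this.symm
  let g : Fin c.length ↪o Fin d.length := OrderEmbedding.ofMapLEIff (fun i => d.index (s c i)) hle
  have hgi : ∀ x, g (c.index x) = d.index x := by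
    intro x
    have h1 := h (s c (c.index x)) x
    have h2 := h x (s c (c.index x))
    unfold compLE at h1 h2
    rw [hs] at h1 h2
    exact le_antisymm (h1.1 le_rfl) (h2.1 le_rfl)
  have hg : Function.Surjective g := fun j => ⟨c.index (s d j), by rw [hgi, hs]⟩
  let G : Fin c.length ≃o Fin d.length := RelIso.ofSurjective g hg
  have hG : ∀ i, ((G i : Fin d.length) : ℕ) = i := fun i => Fin.coe_orderIso_apply G i
  have hlen : c.length = d.length := Fin.equiv_iff_eq.1 ⟨G.toEquiv⟩
  have hb : ∀ i, d.blocksFun (G i) = c.blocksFun i := by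
    intro i
    rw [← card_index_eq, ← card_index_eq]
    congr 1
    ext x
    simp only [Finset.mem_filter, Finset.mem_univ, true_and]
    rw [← hgi x]
    exact G.injective.eq_iff
  apply Composition.ext
  refine List.ext_getElem hlen fun i h1 h2 => ?_
  have h3 := hb ⟨i, h1⟩
  have h4 : G ⟨i, h1⟩ = ⟨i, h2⟩ := Fin.ext (hG _)
  rw [h4] at h3
  exact h3.symm

theorem coeff_qsym {k : ℕ} (c : Composition k) (n : ℕ) (a : Fin n →₀ ℕ) :
    (qsym R c n).coeff a = ∑ f : Fin k → Fin n with ∀ x y, compLE c x y ↔ f x ≤ f y,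
      if ∀ j, (Finset.univ.filter fun x => f x = j).card = a j then 1 else 0 := by
  classical
  rw [qsym, coeff_sum]
  refine Finset.sum_congr rfl fun f _ => ?_
  have : (∏ x, X (f x) : MvPolynomial (Fin n) R) = monomial (∑ x, Finsupp.single (f x) 1) 1 := by
    rw [MvPolynomial.monomial_sum_one]
    rfl
  rw [this, coeff_monomial]
  refine if_congr ?_ rfl rfl
  rw [Finsupp.ext_iff]
  refine forall_congr' fun j => ?_
  rw [Finsupp.finsetSum_apply, Finset.card_filter]
  simp only [Finsupp.single_apply]

theorem coeff_qsym_blocksFun {k : ℕ} (c d : Composition k) :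
    (qsym R c d.length).coeff (Finsupp.equivFunOnFinite.symm d.blocksFun) =
      if c = d then 1 else 0 := by
  classical
  rw [coeff_qsym]
  have key : ∀ f : Fin k → Fin d.length, (∀ x y, compLE c x y ↔ f x ≤ f y) →
      (∀ j, (Finset.univ.filter fun x => f x = j).card =
        Finsupp.equivFunOnFinite.symm d.blocksFun j) → f = d.index := by
    intro f h1 h2
    refine eq_of_fibres (fun x y hxy => (h1 x y).1 (index_mono c hxy)) (index_mono d) ?_
    intro j
    rw [h2, card_index_eq]
    rfl
  split_ifs with h
  · subst h
    rw [Finset.sum_eq_single_of_mem c.index]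
    · rw [if_pos]
      intro j
      rw [card_index_eq]
      rfl
    · simp only [Finset.mem_filter, Finset.mem_univ, true_and]
      exact fun x y => Iff.rfl
    · intro f hf hne
      rw [if_neg]
      intro hc
      exact hne (key f (by simpa using hf) hc)
  · refine Finset.sum_eq_zero fun f hf => ?_
    rw [if_neg]
    intro hc
    have h1 : ∀ x y, compLE c x y ↔ f x ≤ f y := by simpa using hf
    have h2 := key f h1 hc
    apply h
    apply composition_eq_of_compLE
    intro x y
    rw [h1, h2]
    rfl

theorem qsym_isHomogeneous {k : ℕ} (c : Composition k) (n : ℕ) :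
    (qsym R c n).IsHomogeneous k := by
  refine IsHomogeneous.sum _ _ _ fun f _ => ?_
  simpa using IsHomogeneous.prod (Finset.univ : Finset (Fin k)) (fun x => X (R := R) (f x))
    (fun _ => 1) fun x _ => isHomogeneous_X R (f x)

theorem aPoly_isHomogeneous (q : Rˣ) (n d : ℕ) : (aPoly q n d).IsHomogeneous d := by
  intro a ha
  rw [coeff_aPoly] at ha
  have : ∑ i, a i = d := by
    by_contra hc
    exact ha (if_neg hc)
  rw [← this, Finsupp.weight_apply, Finsupp.sum_fintype]
  · simp
  · simp

theorem exists_composition {n k : ℕ} (a : Fin n →₀ ℕ) (ha : ∑ i, a i = k) :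
    ∃ (c : Composition k) (e : Fin c.length → Fin n), StrictMono e ∧
      a = (Finsupp.equivFunOnFinite.symm c.blocksFun : Fin c.length →₀ ℕ).mapDomain e := by
  classical
  let e := a.support.orderEmbOfFin rfl
  have hsum : (List.ofFn fun i => a (e i)).sum = k := by
    rw [List.sum_ofFn, ← ha]
    refine Finset.sum_of_injOn e e.injective.injOn (by simp) ?_ (fun _ _ => rfl)
    intro i _ hi
    by_contra hc
    apply hi
    have : i ∈ Set.range e := by
      rw [Finset.range_orderEmbOfFin]
      simpa using hc
    simpa using this
  let c : Composition k := ⟨List.ofFn fun i => a (e i), by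
    intro i hi
    rw [List.mem_ofFn] at hi
    obtain ⟨j, rfl⟩ := hi
    have := Finset.orderEmbOfFin_mem a.support rfl j
    exact Nat.pos_of_ne_zero (Finsupp.mem_support_iff.1 this), hsum⟩
  have hl : c.length = a.support.card := List.length_ofFn
  have hm : StrictMono fun i => e (Fin.cast hl i) := fun i j hij => e.strictMono hij
  refine ⟨c, fun i => e (Fin.cast hl i), hm, ?_⟩
  ext i
  by_cases hi : i ∈ Set.range fun i => e (Fin.cast hl i)
  · obtain ⟨j, rfl⟩ := hi
    rw [Finsupp.mapDomain_apply hm.injective]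
    simp [c, Composition.blocksFun]
    rfl
  · rw [Finsupp.mapDomain_of_notMem_range _ _ hi]
    by_contra hc
    apply hi
    have : i ∈ Set.range e := by
      rw [Finset.range_orderEmbOfFin]
      simpa using hc
    obtain ⟨j, hj⟩ := this
    exact ⟨Fin.cast hl.symm j, by simpa using hj⟩

/-- The expansion that defines the coefficients `A_{ν, μ}`. -/
theorem aPoly_mul_qsym (q : Rˣ) {k l : ℕ} (h : l ≤ k) (μ : Composition l) (n : ℕ) :
    aPoly q n (k - l) * qsym R μ n = ∑ ν : Composition k, aMul q ν μ • qsym R ν n := by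
  classical
  have h1 : (aPoly q n (k - l) * qsym R μ n).IsHomogeneous k := by
    have := (aPoly_isHomogeneous q n (k - l)).mul (qsym_isHomogeneous (R := R) μ n)
    rwa [Nat.sub_add_cancel h] at this
  have h2 : (∑ ν : Composition k, aMul q ν μ • qsym R ν n).IsHomogeneous k := by
    refine IsHomogeneous.sum _ _ _ fun ν _ => ?_
    rw [smul_eq_C_mul]
    exact (qsym_isHomogeneous ν n).C_mul _
  ext a
  by_cases ha : ∑ i, a i = k
  · obtain ⟨c, e, he, rfl⟩ := exists_composition a ha
    rw [← coeff_killCompl he.injective, ← coeff_killCompl he.injective, map_mul, map_sum,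
      aPoly_killCompl q _ he, qsym_killCompl μ he, coeff_sum]
    simp only [map_smul, qsym_killCompl _ he, coeff_smul, coeff_qsym_blocksFun, smul_eq_mul, mul_ite,
      mul_one, mul_zero]
    rw [Finset.sum_ite_eq', if_pos (Finset.mem_univ _), aMul, if_pos h]
  · have hd : a.degree ≠ k := by
      rwa [Finsupp.degree_eq_sum]
    rw [h1.coeff_eq_zero hd, h2.coeff_eq_zero hd]

/-- `p^c (X_1, …, X_n)` vanishes if `c` has more than `n` parts. -/
theorem qsym_eq_zero {k : ℕ} (c : Composition k) {n : ℕ} (h : n < c.length) : qsym R c n = 0 := by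
  refine Finset.sum_eq_zero fun f hf => ?_
  exfalso
  have hf' : ∀ x y, compLE c x y ↔ f x ≤ f y := by simpa using hf
  let s : Fin c.length → Fin k := fun j => c.embedding j ⟨0, c.one_le_blocksFun j⟩
  have hs : ∀ j, c.index (s j) = j := fun j => c.index_embedding _ _
  have hinj : Function.Injective fun j => f (s j) := by
    intro i j hij
    have h1 := (hf' (s i) (s j)).2 (le_of_eq hij)
    have h2 := (hf' (s j) (s i)).2 (le_of_eq hij.symm)
    unfold compLE at h1 h2
    rw [hs, hs] at h1 h2
    exact le_antisymm h1 h2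
  have := Fintype.card_le_of_injective _ hinj
  simp only [Fintype.card_fin] at this
  omega

end Expansion

end HeckeJM

/-!
The pairing is computed by removing the generators of the increasing element one by one, starting
with the largest.

Write `g_j` for the generators and `L_j` for the Jucys-Murphy operators, with indices starting at
zero, so that `q L_{j+1} = g_j + g_j L_j g_j`. Let `B_j` (`parab`) be the subalgebra generated by
the `g_i` with `i < j`. The trace vanishes on the `B_j`-bimodule `K_j` generated by `g_j`
(`expKer`), so all computations can be done modulo `K_j`. Comparing the generating series of the
powers of `L_j` and `L_{j+1}` shows that modulo `K_j` the elements `L_{j+1} ^ e` and `L_{j+1} ^ e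
g_j` are polynomials in `L_0, …, L_j`, with explicit generating series (`jm_pow_sub_mem_expKer`,
`jm_pow_mul_gen_sub_mem_expKer`). If `e > 0`, these polynomials have degree less than `e`, and the
part of degree `e - 1` of the second one is `∑ d, a_d (L_0, …, L_j) L_j ^ (e - 1 - d)`
(`coeffLow_dS_sub_aS`).

It follows that an increasing word of length `k` pairs to zero with all polynomials of degree less
than `k` (`pairing_eq_zero`), and that the pairing of a word of length `k + 1` and last letter `g_j`
with `p (L_0, …, L_j) L_{j+1} ^ (e + 1)`, in degree at most `k + 1`, is the pairing of the word
without `g_j` with `p ∑ d, a_d L_j ^ (e - d)` (`pairing_succ_mul_X_pow_succ`). Only the monomials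
with last variable `L_{j+1}` contribute to the pairing with a quasi-symmetric polynomial, and `p^μ
(X_0, …, X_{j+1}) = p^μ (X_0, …, X_j) + p^{μ'} (X_0, …, X_j) X_{j+1} ^ e`, where `e` is the last
part of `μ`. Expanding `a_d p^{μ'}` into quasi-symmetric polynomials yields the matrix `A`. The
products of a quasi-symmetric polynomial `p^ν (X_0, …, X_j)` with a power of `X_j` are, up to terms
without `X_j`, the sum of the two quasi-symmetric polynomials obtained by appending the exponent to
`ν` as a new part or adding it to the last part; this yields the matrix `Z`. The two diagonal blocks
correspond to the last two letters being adjacent or not (`pairing_qs_eq_XiMat`).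
-/

namespace HeckeJM

open Equiv MvPolynomial

/-! ### Multiplication by the generators -/

section Generators

variable {R : Type*} [CommRing R] (q : Rˣ) {n : ℕ}

theorem len_inv_le (w : Perm (Fin n)) : len w⁻¹ ≤ len w := by
  obtain ⟨l, hl, hw⟩ := exists_reduced w
  have h : (l.reverse.map (simpleRefl n)).prod = w⁻¹ := by
    rw [← hw, List.prod_inv_reverse, List.map_map, List.map_reverse]
    congr 2
  have := card_invSet_word l.reverse
  rwa [h, ← len_eq, List.length_reverse, hl] at this

theorem len_inv (w : Perm (Fin n)) : len w⁻¹ = len w :=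
  le_antisymm (len_inv_le w) (by simpa using len_inv_le w⁻¹)

theorem T_simpleRefl_sq (i : Fin (n - 1)) :
    (T q (simpleRefl n i) * T q (simpleRefl n i) : Hecke R q n) =
      ((q : R) - 1) • T q (simpleRefl n i) + (q : R) • 1 := by
  have := T_quad (R := R) q i
  rw [Algebra.algebraMap_eq_smul_one, add_mul, mul_sub, one_mul, mul_smul_comm, mul_one] at this
  rw [← sub_eq_zero, ← this]
  module

theorem T_simpleRefl_mul_of_asc {i : Fin (n - 1)} {w : Perm (Fin n)} (h : Asc i w) :
    (T q (simpleRefl n i) * T q w : Hecke R q n) = T q (simpleRefl n i * w) :=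
  T_mul q (by rw [len_of_asc h, len_simpleRefl, add_comm])

theorem T_mul_simpleRefl_of_asc {i : Fin (n - 1)} {w : Perm (Fin n)} (h : Asc i w⁻¹) :
    (T q w * T q (simpleRefl n i) : Hecke R q n) = T q (w * simpleRefl n i) := by
  refine T_mul q ?_
  rw [← len_inv (w * _), mul_inv_rev, simpleRefl_inv, len_of_asc h, len_inv, len_simpleRefl]

theorem T_simpleRefl_mul_of_not_asc {i : Fin (n - 1)} {w : Perm (Fin n)} (h : ¬ Asc i w) :
    (T q (simpleRefl n i) * T q w : Hecke R q n) =
      ((q : R) - 1) • T q w + (q : R) • T q (simpleRefl n i * w) := by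
  have h2 := T_simpleRefl_mul_of_asc (R := R) q (asc_simpleRefl_mul.2 h)
  rw [← mul_assoc, simpleRefl_mul_self, one_mul] at h2
  rw [← h2, ← mul_assoc, T_simpleRefl_sq, add_mul, smul_mul_assoc, h2, smul_mul_assoc, one_mul]

theorem T_mul_simpleRefl_of_not_asc {i : Fin (n - 1)} {w : Perm (Fin n)} (h : ¬ Asc i w⁻¹) :
    (T q w * T q (simpleRefl n i) : Hecke R q n) =
      ((q : R) - 1) • T q w + (q : R) • T q (w * simpleRefl n i) := by
  have h1 : Asc i (w * simpleRefl n i)⁻¹ := by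
    rw [mul_inv_rev, simpleRefl_inv]
    exact asc_simpleRefl_mul.2 h
  have h2 := T_mul_simpleRefl_of_asc (R := R) q h1
  rw [mul_assoc, simpleRefl_mul_self, mul_one] at h2
  rw [← h2, mul_assoc, T_simpleRefl_sq, mul_add, mul_smul_comm, h2, mul_smul_comm, mul_one]

/-! ### The trace -/

/-- The trace as a linear form. -/
noncomputable def traceLin : Hecke R q n →ₗ[R] R :=
  (Finsupp.lapply 1).comp (heckeBasis R q n).repr.toLinearMap

theorem traceLin_T (w : Perm (Fin n)) :
    traceLin q (T q w : Hecke R q n) = if w = 1 then 1 else 0 :=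
  heckeTrace_T q w

theorem not_asc_simpleRefl (i : Fin (n - 1)) : ¬ Asc i (simpleRefl n i) := by
  have h : Asc i (1 : Perm (Fin n)) := by simp [Asc]
  have := asc_simpleRefl_mul (i := i) (w := 1)
  rw [mul_one] at this
  exact fun hc => this.1 hc h

theorem traceLin_simpleRefl_mul (i : Fin (n - 1)) (w : Perm (Fin n)) :
    traceLin q (T q (simpleRefl n i) * T q w : Hecke R q n) =
      if w = simpleRefl n i then (q : R) else 0 := by
  have e : simpleRefl n i * w = 1 ↔ w = simpleRefl n i := by
    rw [mul_eq_one_iff_inv_eq, simpleRefl_inv, eq_comm]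
  by_cases h : Asc i w
  · rw [T_simpleRefl_mul_of_asc q h, traceLin_T, if_neg, if_neg]
    · rintro rfl
      exact not_asc_simpleRefl i h
    · rw [e]
      rintro rfl
      exact not_asc_simpleRefl i h
  · have h1 : w ≠ 1 := by
      rintro rfl
      exact h (by simp [Asc])
    rw [T_simpleRefl_mul_of_not_asc q h, map_add, map_smul, map_smul, traceLin_T, traceLin_T,
      if_neg h1]
    simp [e]

theorem traceLin_mul_simpleRefl (i : Fin (n - 1)) (w : Perm (Fin n)) :
    traceLin q (T q w * T q (simpleRefl n i) : Hecke R q n) =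
      if w = simpleRefl n i then (q : R) else 0 := by
  have e : w * simpleRefl n i = 1 ↔ w = simpleRefl n i := by
    rw [mul_eq_one_iff_eq_inv, simpleRefl_inv]
  by_cases h : Asc i w⁻¹
  · have h2 : w ≠ simpleRefl n i := by
      rintro rfl
      rw [simpleRefl_inv] at h
      exact not_asc_simpleRefl i h
    rw [T_mul_simpleRefl_of_asc q h, traceLin_T, if_neg, if_neg h2]
    rwa [e]
  · have h1 : w ≠ 1 := by
      rintro rfl
      exact h (by simp [Asc])
    rw [T_mul_simpleRefl_of_not_asc q h, map_add, map_smul, map_smul, traceLin_T, traceLin_T,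
      if_neg h1]
    simp [e]

theorem hecke_induction {p : Hecke R q n → Prop} (h : Hecke R q n) (zero : p 0)
    (add : ∀ x y, p x → p y → p (x + y)) (smul_T : ∀ (r : R) w, p (r • T q w)) : p h := by
  have hx := T_span (R := R) q (Submodule.mem_top (x := h))
  induction hx using Submodule.span_induction with
  | mem x hx =>
    obtain ⟨w, rfl⟩ := hx
    simpa using smul_T 1 w
  | zero => exact zero
  | add x y _ _ hx hy => exact add x y hx hy
  | smul r x hx _ =>
    clear * - zero add smul_T hx
    induction hx using Submodule.span_induction generalizing r with
    | mem x hx =>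
      obtain ⟨w, rfl⟩ := hx
      exact smul_T r w
    | zero => simpa using zero
    | add x y _ _ hx hy =>
      rw [smul_add]
      exact add _ _ (hx r) (hy r)
    | smul s x _ hx =>
      rw [smul_smul]
      exact hx _

theorem traceLin_simpleRefl_comm (i : Fin (n - 1)) (h : Hecke R q n) :
    traceLin q (T q (simpleRefl n i) * h) = traceLin q (h * T q (simpleRefl n i)) := by
  induction h using hecke_induction with
  | zero => simp
  | add x y hx hy => rw [mul_add, add_mul, map_add, map_add, hx, hy]
  | smul_T r w =>
    rw [mul_smul_comm, smul_mul_assoc, map_smul, map_smul, traceLin_simpleRefl_mul,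
      traceLin_mul_simpleRefl]

/-! ### Generators and the parabolic filtration -/

/-- The generator `T_{s_{i+1}}` of the Hecke algebra. It is set to `0` if there is no such
generator, so that the relations between distinct generators hold for all indices. -/
noncomputable def gen (R : Type*) [CommRing R] (q : Rˣ) (n i : ℕ) : Hecke R q n :=
  if h : i < n - 1 then T q (simpleRefl n ⟨i, h⟩) else 0

theorem gen_of_lt {i : ℕ} (h : i < n - 1) : gen R q n i = T q (simpleRefl n ⟨i, h⟩) := dif_pos h

theorem gen_of_not_lt {i : ℕ} (h : ¬ i < n - 1) : gen R q n i = 0 := dif_neg h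

theorem gen_sq {i : ℕ} (h : i < n - 1) :
    gen R q n i * gen R q n i = ((q : R) - 1) • gen R q n i + (q : R) • 1 := by
  rw [gen_of_lt q h, T_simpleRefl_sq]

theorem traceLin_gen_comm (i : ℕ) (h : Hecke R q n) :
    traceLin q (gen R q n i * h) = traceLin q (h * gen R q n i) := by
  by_cases hi : i < n - 1
  · rw [gen_of_lt q hi, traceLin_simpleRefl_comm]
  · rw [gen_of_not_lt q hi, zero_mul, mul_zero]

theorem gen_comm {i j : ℕ} (h : i + 1 < j) : Commute (gen R q n i) (gen R q n j) := by
  by_cases hj : j < n - 1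
  · have hi : i < n - 1 := by omega
    rw [gen_of_lt q hj, gen_of_lt q hi, Commute, SemiconjBy, T_simpleRefl_mul_of_asc,
      T_simpleRefl_mul_of_asc]
    · congr 1
      ext x
      simp only [Perm.mul_apply, simpleRefl_apply]
      split_ifs <;> omega
    all_goals
      simp only [Asc, simpleRefl_inv, Fin.lt_def, simpleRefl_apply]
      split_ifs <;> omega
  · rw [gen_of_not_lt q hj]
    exact Commute.zero_right _

theorem gen_braid (i : ℕ) : gen R q n i * gen R q n (i + 1) * gen R q n i =
    gen R q n (i + 1) * gen R q n i * gen R q n (i + 1) := by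
  by_cases hj : i + 1 < n - 1
  · have hi : i < n - 1 := by omega
    rw [gen_of_lt q hj, gen_of_lt q hi, mul_assoc, mul_assoc, T_simpleRefl_mul_of_asc,
      T_simpleRefl_mul_of_asc, T_simpleRefl_mul_of_asc, T_simpleRefl_mul_of_asc]
    · congr 1
      ext x
      simp only [Perm.mul_apply, simpleRefl_apply]
      split_ifs <;> omega
    all_goals
      simp only [Asc, mul_inv_rev, Perm.mul_apply, simpleRefl_inv, Fin.lt_def, simpleRefl_apply]
      split_ifs <;> omega
  · rw [gen_of_not_lt q hj]
    simp

/-- The subalgebra generated by the first `j` generators: the Hecke algebra of the symmetric group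
on the first `j + 1` letters. -/
noncomputable def parab (R : Type*) [CommRing R] (q : Rˣ) (n j : ℕ) : Subalgebra R (Hecke R q n) :=
  Algebra.adjoin R (gen R q n '' Set.Iio j)

theorem gen_mem_parab {i j : ℕ} (h : i < j) : gen R q n i ∈ parab R q n j :=
  Algebra.subset_adjoin ⟨i, h, rfl⟩

theorem parab_mono {i j : ℕ} (h : i ≤ j) : parab R q n i ≤ parab R q n j :=
  Algebra.adjoin_mono (Set.image_mono (Set.Iio_subset_Iio h))

theorem commute_of_mem_parab {j : ℕ} {x y : Hecke R q n} (hy : y ∈ parab R q n j)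
    (h : ∀ i < j, Commute x (gen R q n i)) : Commute x y := by
  have : parab R q n j ≤ Subalgebra.centralizer R {x} := by
    refine Algebra.adjoin_le ?_
    rintro _ ⟨i, hi, rfl⟩
    rw [SetLike.mem_coe, Subalgebra.mem_centralizer_iff]
    rintro _ rfl
    exact h i hi
  exact (Subalgebra.mem_centralizer_iff R).1 (this hy) _ rfl

theorem gen_commute_parab {j : ℕ} {y : Hecke R q n} (hy : y ∈ parab R q n j) :
    Commute (gen R q n (j + 1)) y :=
  commute_of_mem_parab q hy fun _ hi => (gen_comm q (by omega)).symm

theorem traceLin_comm_of_mem {j : ℕ} {x : Hecke R q n} (hx : x ∈ parab R q n j)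
    (y : Hecke R q n) : traceLin q (x * y) = traceLin q (y * x) := by
  induction hx using Algebra.adjoin_induction generalizing y with
  | mem x hx =>
    obtain ⟨i, -, rfl⟩ := hx
    exact traceLin_gen_comm q i y
  | algebraMap r => rw [Algebra.commutes]
  | add x x' _ _ h h' => rw [add_mul, mul_add, map_add, map_add, h, h']
  | mul x x' _ _ h h' => rw [mul_assoc, h, mul_assoc, h', mul_assoc]

/-- The permutations that fix the letters after the first `j + 1` letters. -/
def FixesAbove (j : ℕ) (w : Perm (Fin n)) : Prop := ∀ x : Fin n, j < x → w x = x

theorem FixesAbove.le {j : ℕ} {w : Perm (Fin n)} (h : FixesAbove j w) {x : Fin n}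
    (hx : (x : ℕ) ≤ j) : (w x : ℕ) ≤ j := by
  by_contra hc
  have := w.injective (h (w x) (by omega))
  rw [this] at hc
  exact hc hx

theorem FixesAbove.simpleRefl_mul {i : Fin (n - 1)} {j : ℕ} {w : Perm (Fin n)}
    (h : FixesAbove j w) (hi : (i : ℕ) < j) : FixesAbove j (simpleRefl n i * w) := by
  intro x hx
  ext
  rw [Perm.mul_apply, h x hx, simpleRefl_apply]
  split_ifs <;> omega

theorem parab_le_span (j : ℕ) : Subalgebra.toSubmodule (parab R q n j) ≤
    Submodule.span R (T q '' {w : Perm (Fin n) | FixesAbove j w}) := by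
  set M := Submodule.span R ((T q : _ → Hecke R q n) '' {w : Perm (Fin n) | FixesAbove j w}) with hM
  have hs : ∀ i < j, ∀ x ∈ M, gen R q n i * x ∈ M := by
    intro i hij x hx
    by_cases hi : i < n - 1
    · rw [gen_of_lt q hi]
      induction hx using Submodule.span_induction with
      | mem x hx =>
        obtain ⟨w, hw, rfl⟩ := hx
        have h1 : T q (simpleRefl n ⟨i, hi⟩ * w) ∈ M :=
          Submodule.subset_span ⟨_, hw.simpleRefl_mul hij, rfl⟩
        by_cases ha : Asc ⟨i, hi⟩ w
        · rwa [T_simpleRefl_mul_of_asc q ha]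
        · rw [T_simpleRefl_mul_of_not_asc q ha]
          exact add_mem (M.smul_mem _ (Submodule.subset_span ⟨w, hw, rfl⟩)) (M.smul_mem _ h1)
      | zero => simp
      | add x y _ _ hx hy => rw [mul_add]; exact add_mem hx hy
      | smul r x _ hx => rw [mul_smul_comm]; exact M.smul_mem _ hx
    · rw [gen_of_not_lt q hi, zero_mul]
      exact zero_mem _
  intro x hx
  suffices h : ∀ y ∈ M, x * y ∈ M by
    have h1 : (1 : Hecke R q n) ∈ M := by
      rw [← T_one]
      exact Submodule.subset_span ⟨1, fun _ _ => rfl, rfl⟩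
    simpa using h 1 h1
  have hx' : x ∈ parab R q n j := hx
  clear hx
  induction hx' using Algebra.adjoin_induction with
  | mem x hx =>
    obtain ⟨i, hi, rfl⟩ := hx
    exact hs i hi
  | algebraMap r =>
    intro y hy
    rw [← Algebra.smul_def]
    exact M.smul_mem _ hy
  | add x x' h1 h2 h h' =>
    intro y hy
    rw [add_mul]
    exact add_mem (h y hy) (h' y hy)
  | mul x x' h1 h2 h h' =>
    intro y hy
    rw [mul_assoc]
    exact h _ (h' y hy)

theorem traceLin_mul_gen {j : ℕ} {x : Hecke R q n} (hx : x ∈ parab R q n j) :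
    traceLin q (x * gen R q n j) = 0 := by
  by_cases hj : j < n - 1
  · rw [gen_of_lt q hj]
    have : Submodule.span R (T q '' {w : Perm (Fin n) | FixesAbove j w}) ≤ LinearMap.ker
        ((traceLin q).comp (LinearMap.mulRight R (T q (simpleRefl n ⟨j, hj⟩) : Hecke R q n))) := by
      refine Submodule.span_le.2 ?_
      rintro _ ⟨w, hw, rfl⟩
      rw [SetLike.mem_coe, LinearMap.mem_ker, LinearMap.comp_apply, LinearMap.mulRight_apply,
        traceLin_mul_simpleRefl, if_neg]
      rintro rfl
      have := hw (hi ⟨j, hj⟩) (by simp)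
      rw [simpleRefl_hi] at this
      exact (lo_lt_hi _).ne this
    exact this (parab_le_span q j hx)
  · rw [gen_of_not_lt q hj, mul_zero, map_zero]

/-- The `parab j`-subbimodule of the Hecke algebra generated by the generator with index `j`. It is
the part of the Hecke algebra on `j + 2` letters that the conditional expectation onto the Hecke
algebra on `j + 1` letters kills. Congruence modulo it takes the place of this expectation. -/
noncomputable def expKer (R : Type*) [CommRing R] (q : Rˣ) (n j : ℕ) : Submodule R (Hecke R q n) :=
  Submodule.span R {z | ∃ a ∈ parab R q n j, ∃ b ∈ parab R q n j, z = a * gen R q n j * b}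

theorem mul_gen_mul_mem_expKer {j : ℕ} {a b : Hecke R q n} (ha : a ∈ parab R q n j)
    (hb : b ∈ parab R q n j) : a * gen R q n j * b ∈ expKer R q n j :=
  Submodule.subset_span ⟨a, ha, b, hb, rfl⟩

theorem mul_mem_expKer {j : ℕ} {a z : Hecke R q n} (ha : a ∈ parab R q n j)
    (hz : z ∈ expKer R q n j) : a * z ∈ expKer R q n j := by
  induction hz using Submodule.span_induction with
  | mem z hz =>
    obtain ⟨b, hb, c, hc, rfl⟩ := hz
    rw [← mul_assoc, ← mul_assoc]
    exact mul_gen_mul_mem_expKer q (mul_mem ha hb) hc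
  | zero => simp
  | add x y _ _ hx hy => rw [mul_add]; exact add_mem hx hy
  | smul r x _ hx => rw [mul_smul_comm]; exact Submodule.smul_mem _ _ hx

theorem expKer_mul_mem {j : ℕ} {a z : Hecke R q n} (ha : a ∈ parab R q n j)
    (hz : z ∈ expKer R q n j) : z * a ∈ expKer R q n j := by
  induction hz using Submodule.span_induction with
  | mem z hz =>
    obtain ⟨b, hb, c, hc, rfl⟩ := hz
    rw [mul_assoc]
    exact mul_gen_mul_mem_expKer q hb (mul_mem hc ha)
  | zero => simp
  | add x y _ _ hx hy => rw [add_mul]; exact add_mem hx hy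
  | smul r x _ hx => rw [smul_mul_assoc]; exact Submodule.smul_mem _ _ hx

theorem traceLin_expKer {j : ℕ} {z : Hecke R q n} (hz : z ∈ expKer R q n j) :
    traceLin q z = 0 := by
  have : expKer R q n j ≤ LinearMap.ker (traceLin q) := by
    refine Submodule.span_le.2 ?_
    rintro _ ⟨a, ha, b, hb, rfl⟩
    rw [SetLike.mem_coe, LinearMap.mem_ker, ← traceLin_comm_of_mem q hb, ← mul_assoc]
    exact traceLin_mul_gen q (mul_mem hb ha)
  exact this hz

/-- Conjugation by the next generator maps the kernel of one conditional expectation to the kernel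
of the next, by the braid relation. -/
theorem gen_mul_expKer_mul_gen {j : ℕ} {z : Hecke R q n} (hz : z ∈ expKer R q n j) :
    gen R q n (j + 1) * z * gen R q n (j + 1) ∈ expKer R q n (j + 1) := by
  induction hz using Submodule.span_induction with
  | mem z hz =>
    obtain ⟨a, ha, b, hb, rfl⟩ := hz
    have h : gen R q n (j + 1) * (a * gen R q n j * b) * gen R q n (j + 1) =
        (a * gen R q n j) * gen R q n (j + 1) * (gen R q n j * b) := by
      have h1 := (gen_commute_parab q ha).eq
      have h2 := (gen_commute_parab q hb).eq
      calc _ = (gen R q n (j + 1) * a) * gen R q n j * (b * gen R q n (j + 1)) := by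
            simp only [mul_assoc]
        _ = a * (gen R q n (j + 1) * gen R q n j * gen R q n (j + 1)) * b := by
            rw [h1, ← h2]; simp only [mul_assoc]
        _ = _ := by rw [← gen_braid]; simp only [mul_assoc]
    rw [h]
    have hg := gen_mem_parab (R := R) (n := n) q j.lt_succ_self
    exact mul_gen_mul_mem_expKer q (mul_mem (parab_mono q j.le_succ ha) hg)
      (mul_mem hg (parab_mono q j.le_succ hb))
  | zero => simp
  | add x y _ _ hx hy => rw [mul_add, add_mul]; exact add_mem hx hy
  | smul r x _ hx => rw [mul_smul_comm, smul_mul_assoc]; exact Submodule.smul_mem _ _ hx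

/-! ### Jucys-Murphy operators -/

/-- The Jucys-Murphy operators, defined by the recursion `L_{j+1} = q⁻¹ (g_j + g_j L_j g_j)`. -/
noncomputable def jm (R : Type*) [CommRing R] (q : Rˣ) (n : ℕ) : ℕ → Hecke R q n
  | 0 => 0
  | j + 1 => ((q⁻¹ : Rˣ) : R) • (gen R q n j + gen R q n j * jm R q n j * gen R q n j)

theorem jm_mem_parab (j : ℕ) : jm R q n j ∈ parab R q n j := by
  induction j with
  | zero => exact zero_mem _
  | succ j ih =>
    have hg := gen_mem_parab (R := R) (n := n) q j.lt_succ_self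
    exact Subalgebra.smul_mem _
      (add_mem hg (mul_mem (mul_mem hg (parab_mono q j.le_succ ih)) hg)) _

theorem jm_succ_eq_zero {j : ℕ} (h : ¬ j < n - 1) : jm R q n (j + 1) = 0 := by
  simp [jm, gen_of_not_lt q h]

theorem smul_jm_succ (j : ℕ) : (q : R) • jm R q n (j + 1) =
    gen R q n j + gen R q n j * jm R q n j * gen R q n j := by
  rw [jm, smul_smul, Units.mul_inv, one_smul]

/-- The operator `L_{j+1}` commutes with the generators of the Hecke algebra on the first `j + 1`
letters. The only generator that needs an argument is `g_{j-1}`, where the expansion of `L_{j+1}` in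
terms of `L_{j-1}` is used. -/
theorem jm_succ_commute_gen {i j : ℕ} (h : i < j) : Commute (jm R q n (j + 1)) (gen R q n i) := by
  suffices hs : Commute ((q : R) • jm R q n (j + 1)) (gen R q n i) by
    have := hs.smul_left ((q⁻¹ : Rˣ) : R)
    rwa [smul_smul, Units.inv_mul, one_smul] at this
  rw [smul_jm_succ]
  induction j with
  | zero => omega
  | succ j ih =>
    rcases Nat.lt_succ_iff_lt_or_eq.1 h with hij | rfl
    · have h1 := (gen_comm (R := R) (n := n) q (Nat.succ_lt_succ hij)).symm
      have h2 : Commute (jm R q n (j + 1)) (gen R q n i) := by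
        rw [jm]
        exact (ih hij).smul_left _
      exact h1.add_left ((h1.mul_left h2).mul_left h1)
    · by_cases hi : i < n - 1
      · have hLb := (gen_commute_parab (n := n) q (jm_mem_parab (R := R) (n := n) q i)).eq
        have hab := gen_braid (R := R) (n := n) q i
        have haa := gen_sq (R := R) (n := n) q hi
        have hL := smul_jm_succ (R := R) (n := n) q i
        generalize gen R q n (i + 1) = b at *
        generalize gen R q n i = a at *
        generalize jm R q n i = L at *
        -- Up to a power of `q`, `L_{i+2}` is the sum of two terms: the first commutes with `a` by the
        -- quadratic relation, the second one by the braid relation.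
        have e : (q : R) • (b + b * jm R q n (i + 1) * b) =
            ((q : R) • b + b * a * b) + b * a * L * a * b := by
          rw [smul_add, ← smul_mul_assoc, ← mul_smul_comm, hL]
          simp only [mul_add, add_mul, mul_assoc, add_assoc]
        have c1 : Commute ((q : R) • b + b * a * b) a := by
          rw [← hab]
          show ((q : R) • b + a * b * a) * a = a * ((q : R) • b + a * b * a)
          have e1 : a * b * a * a = (a * b) * (a * a) := by simp only [mul_assoc]
          have e2 : a * (a * b * a) = (a * a) * (b * a) := by simp only [mul_assoc]
          rw [add_mul, mul_add, e1, e2, haa]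
          simp only [mul_add, add_mul, smul_mul_assoc, mul_smul_comm, mul_one, one_mul, mul_assoc]
          abel
        have c2 : Commute (b * a * L * a * b) a := by
          show b * a * L * a * b * a = a * (b * a * L * a * b)
          calc b * a * L * a * b * a = b * a * L * (a * b * a) := by simp only [mul_assoc]
            _ = b * a * (L * b) * a * b := by rw [hab]; simp only [mul_assoc]
            _ = (b * a * b) * L * a * b := by rw [← hLb]; simp only [mul_assoc]
            _ = _ := by rw [← hab]; simp only [mul_assoc]
        have c3 := (c1.add_left c2).smul_left ((q⁻¹ : Rˣ) : R)
        rwa [← e, smul_smul, Units.inv_mul, one_smul] at c3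
      · rw [gen_of_not_lt q hi]
        exact Commute.zero_right _

theorem jm_succ_commute_parab {j : ℕ} {y : Hecke R q n} (hy : y ∈ parab R q n j) :
    Commute (jm R q n (j + 1)) y :=
  commute_of_mem_parab q hy fun _ => jm_succ_commute_gen q

theorem jm_commute (i j : ℕ) : Commute (jm R q n i) (jm R q n j) := by
  have key : ∀ i j, i < j → Commute (jm R q n j) (jm R q n i) := by
    intro i j hij
    obtain ⟨j, rfl⟩ : ∃ k, j = k + 1 := ⟨j - 1, by omega⟩
    exact jm_succ_commute_parab q (parab_mono q (by omega) (jm_mem_parab q i))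
  rcases lt_trichotomy i j with h | rfl | h
  · exact (key i j h).symm
  · exact Commute.refl _
  · exact key j i h

theorem jm_succ_mul_gen {j : ℕ} (h : j < n - 1) :
    jm R q n (j + 1) * gen R q n j =
      ((q : R) - 1) • jm R q n (j + 1) + 1 + gen R q n j * jm R q n j := by
  have hL := smul_jm_succ (R := R) (n := n) q j
  have e : (q : R) • (jm R q n (j + 1) * gen R q n j) =
      (q : R) • (((q : R) - 1) • jm R q n (j + 1) + 1 + gen R q n j * jm R q n j) := by
    rw [← smul_mul_assoc, hL, smul_add, smul_add, smul_comm, hL, add_mul, mul_assoc (_ * _),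
      gen_sq q h]
    simp only [mul_add, mul_smul_comm, mul_one]
    module
  have := congrArg (fun x => ((q⁻¹ : Rˣ) : R) • x) e
  simpa only [smul_smul, Units.inv_mul, one_smul] using this

theorem swap_conj {i j : ℕ} (hj : j < i) (hi : i < n - 1) :
    swap (⟨j, by omega⟩ : Fin n) ⟨i + 1, by omega⟩ =
      simpleRefl n ⟨i, hi⟩ * (swap ⟨j, by omega⟩ ⟨i, by omega⟩ * simpleRefl n ⟨i, hi⟩) := by
  rw [← mul_assoc, Equiv.mul_swap_eq_swap_mul, mul_assoc, simpleRefl_mul_self, mul_one]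
  congr 1
  · ext
    rw [simpleRefl_apply]
    simp only
    split_ifs <;> omega
  · exact (simpleRefl_lo ⟨i, hi⟩).symm

theorem T_swap_succ {i j : ℕ} (hj : j < i) (hi : i < n - 1) :
    (T q (swap (⟨j, by omega⟩ : Fin n) ⟨i + 1, by omega⟩) : Hecke R q n) =
      gen R q n i * T q (swap ⟨j, by omega⟩ ⟨i, by omega⟩) * gen R q n i := by
  rw [swap_conj hj hi, gen_of_lt q hi, mul_assoc, T_mul_simpleRefl_of_asc,
    T_simpleRefl_mul_of_asc]
  · simp only [Asc, mul_inv_rev, Perm.mul_apply, simpleRefl_inv, Fin.lt_def, simpleRefl_apply,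
      swap_inv, swap_apply_def, Fin.ext_iff]
    split_ifs <;> simp_all <;> omega
  · simp only [Asc, swap_inv, Fin.lt_def, swap_apply_def, Fin.ext_iff]
    split_ifs <;> simp_all <;> omega

/-- The recursive definition of the Jucys-Murphy operators agrees with the one as a sum. -/
theorem jucysMurphy_eq (i : Fin n) : jucysMurphy R q n i = jm R q n i := by
  obtain ⟨i, hi⟩ := i
  have key : ∀ i (hi : i < n), jucysMurphy R q n ⟨i, hi⟩ = ∑ j : Fin i,
      ((q ^ ((j : ℤ) - (i : ℤ)) : Rˣ) : R) • T q (swap (⟨j, by omega⟩ : Fin n) ⟨i, hi⟩) := by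
    intro i hi
    rw [jucysMurphy]
    symm
    refine Finset.sum_of_injOn (fun j : Fin i => (⟨j, by omega⟩ : Fin n)) ?_ ?_ ?_ ?_
    · intro a _ b _ h
      simpa [Fin.ext_iff] using h
    · intro a _
      simp [Fin.lt_def]
    · intro x hx hx'
      exfalso
      simp only [Finset.mem_filter, Finset.mem_univ, true_and, Fin.lt_def] at hx
      exact hx' ⟨⟨x, hx⟩, by simp, rfl⟩
    · intro a _
      rfl
  induction i with
  | zero =>
    rw [key]
    simp [jm]
  | succ i ih =>
    have hi' : i < n - 1 := by omega
    have ih' := ih (by omega) key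
    rw [key] at ih' ⊢
    rw [Fin.sum_univ_castSucc, jm, ← ih']
    simp only [Fin.val_castSucc, Fin.val_last, T_swap_succ q (Fin.is_lt _) hi', Finset.mul_sum,
      Finset.sum_mul, mul_smul_comm, smul_mul_assoc, smul_add, Finset.smul_sum, smul_smul,
      ← Units.val_mul]
    rw [add_comm, gen_of_lt q hi']
    congr 1
    · congr 2
      push_cast
      simp
    · refine Finset.sum_congr rfl fun x _ => ?_
      congr 2
      rw [← zpow_neg_one, ← zpow_add]
      congr 1
      push_cast
      ring

end Generators

/-! ### Polynomials of bounded degree -/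

section Degree

variable {R : Type*} [CommRing R]

/-- The polynomials in the variables `X_0, …, X_{j-1}` all of whose monomials have degree less than
`e`. -/
noncomputable def lowDeg (R : Type*) [CommRing R] (j e : ℕ) : Submodule R (MvPolynomial ℕ R) :=
  restrictSupport R {m | ↑m.support ⊆ Set.Iio j ∧ m.degree < e}

theorem mem_lowDeg {j e : ℕ} {p : MvPolynomial ℕ R} :
    p ∈ lowDeg R j e ↔ ∀ m ∈ p.support, ↑m.support ⊆ Set.Iio j ∧ m.degree < e :=
  Iff.rfl

theorem lowDeg_mono {j j' e e' : ℕ} (hj : j ≤ j') (he : e ≤ e') : lowDeg R j e ≤ lowDeg R j' e' :=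
  restrictSupport_mono R fun _ hm => ⟨hm.1.trans (Set.Iio_subset_Iio hj), hm.2.trans_le he⟩

theorem eq_zero_of_mem_lowDeg {j : ℕ} {p : MvPolynomial ℕ R} (h : p ∈ lowDeg R j 0) : p = 0 := by
  rw [← support_eq_empty, Finset.eq_empty_iff_forall_notMem]
  exact fun m hm => absurd (mem_lowDeg.1 h m hm).2 (Nat.not_lt_zero _)

theorem monomial_mem_lowDeg {j e : ℕ} {m : ℕ →₀ ℕ} (h : ↑m.support ⊆ Set.Iio j)
    (he : m.degree < e) (r : R) : monomial m r ∈ lowDeg R j e :=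
  (monomial_mem_restrictSupport R).2 (Or.inl ⟨h, he⟩)

theorem C_mem_lowDeg (j e : ℕ) (r : R) : (C r : MvPolynomial ℕ R) ∈ lowDeg R j (e + 1) :=
  monomial_mem_lowDeg (by simp) (by simp) r

theorem one_mem_lowDeg (j e : ℕ) : (1 : MvPolynomial ℕ R) ∈ lowDeg R j (e + 1) :=
  C_mem_lowDeg j e 1

theorem X_pow_mem_lowDeg {i j : ℕ} (h : i < j) (e : ℕ) :
    (X i ^ e : MvPolynomial ℕ R) ∈ lowDeg R j (e + 1) := by
  rw [X_pow_eq_monomial]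
  refine monomial_mem_lowDeg ?_ (by simp) 1
  refine (Finset.coe_subset.2 Finsupp.support_single_subset).trans ?_
  simpa using h

theorem mul_mem_lowDeg {j a b : ℕ} {p r : MvPolynomial ℕ R} (hp : p ∈ lowDeg R j (a + 1))
    (hr : r ∈ lowDeg R j b) : p * r ∈ lowDeg R j (a + b) := by
  classical
  refine mem_lowDeg.2 fun m hm => ?_
  obtain ⟨u, hu, v, hv, rfl⟩ := Finset.mem_add.1 (support_mul p r hm)
  have h1 := mem_lowDeg.1 hp u hu
  have h2 := mem_lowDeg.1 hr v hv
  constructor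
  · refine (Finset.coe_subset.2 Finsupp.support_add).trans ?_
    rw [Finset.coe_union]
    exact Set.union_subset h1.1 h2.1
  · rw [map_add]
    omega

/-- For all `e`, the coefficient of the power series at `X ^ e` is in the first `j` variables and
has degree less than `e + s`. -/
def CoeffLow (j s : ℕ) (F : PowerSeries (MvPolynomial ℕ R)) : Prop :=
  ∀ e, PowerSeries.coeff e F ∈ lowDeg R j (e + s)

theorem CoeffLow.mono {j j' s s' : ℕ} {F : PowerSeries (MvPolynomial ℕ R)} (h : CoeffLow j s F)
    (hj : j ≤ j') (hs : s ≤ s') : CoeffLow j' s' F :=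
  fun e => lowDeg_mono hj (by omega) (h e)

theorem CoeffLow.add {j s : ℕ} {F G : PowerSeries (MvPolynomial ℕ R)} (hF : CoeffLow j s F)
    (hG : CoeffLow j s G) : CoeffLow j s (F + G) :=
  fun e => by rw [map_add]; exact add_mem (hF e) (hG e)

theorem CoeffLow.sub {j s : ℕ} {F G : PowerSeries (MvPolynomial ℕ R)} (hF : CoeffLow j s F)
    (hG : CoeffLow j s G) : CoeffLow j s (F - G) :=
  fun e => by rw [map_sub]; exact sub_mem (hF e) (hG e)

theorem CoeffLow.mul {j s : ℕ} {F G : PowerSeries (MvPolynomial ℕ R)} (hF : CoeffLow j 1 F)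
    (hG : CoeffLow j s G) : CoeffLow j s (F * G) := by
  intro e
  rw [PowerSeries.coeff_mul]
  refine Submodule.sum_mem _ fun p hp => ?_
  rw [← Finset.HasAntidiagonal.mem_antidiagonal.1 hp, add_assoc]
  exact mul_mem_lowDeg (hF _) (hG _)

theorem coeffLow_C (j : ℕ) (r : R) : CoeffLow j 1 (PowerSeries.C (C r : MvPolynomial ℕ R)) := by
  intro e
  rw [PowerSeries.coeff_C]
  split_ifs
  · exact C_mem_lowDeg j e r
  · exact zero_mem _

theorem coeffLow_one (j : ℕ) : CoeffLow j 1 (1 : PowerSeries (MvPolynomial ℕ R)) := by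
  simpa using coeffLow_C (R := R) j 1

theorem coeffLow_X (j : ℕ) : CoeffLow j 0 (PowerSeries.X : PowerSeries (MvPolynomial ℕ R)) := by
  intro e
  rw [PowerSeries.coeff_X]
  split_ifs with h
  · subst h
    exact one_mem_lowDeg j 0
  · exact zero_mem _

/-- Division by a power series with invertible constant coefficient preserves bounds on degrees. -/
theorem CoeffLow.of_mul {j s : ℕ} {F G : PowerSeries (MvPolynomial ℕ R)} (u : Rˣ)
    (hu : PowerSeries.coeff 0 G = C (u : R)) (hG : CoeffLow j 1 G) (h : CoeffLow j s (F * G)) :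
    CoeffLow j s F := by
  intro e
  induction e using Nat.strong_induction_on with
  | _ e ih =>
    have h1 := h e
    rw [PowerSeries.coeff_mul, ← Finset.add_sum_erase _ _ 
      (Finset.HasAntidiagonal.mem_antidiagonal (a := (e, 0)).2 (add_zero e)),
      hu] at h1
    have h2 : ∑ p ∈ (Finset.HasAntidiagonal.antidiagonal e).erase (e, 0),
        PowerSeries.coeff p.1 F * PowerSeries.coeff p.2 G ∈ lowDeg R j (e + s) := by
      refine Submodule.sum_mem _ fun p hp => ?_
      rw [Finset.mem_erase, Finset.HasAntidiagonal.mem_antidiagonal] at hp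
      obtain ⟨h3, h4⟩ := hp
      have h5 : p.1 < e := by
        by_contra hc
        exact h3 (Prod.ext (by simp only; omega) (by simp only; omega))
      rw [mul_comm, ← h4, add_comm p.1, add_assoc]
      exact mul_mem_lowDeg (hG _) (ih _ h5)
    have h3 := Submodule.smul_mem _ ((u⁻¹ : Rˣ) : R) ((Submodule.add_mem_iff_left _ h2).1 h1)
    rwa [mul_comm, C_mul', smul_smul, Units.inv_mul, one_smul] at h3

end Degree

/-! ### The generating series of the conditional expectations -/

section Series

variable {R : Type*} [CommRing R] (q : Rˣ)

local notation "κ" r => PowerSeries.C (C r : MvPolynomial ℕ R)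

/-- The geometric series `∑ e, a ^ e X ^ e`. -/
noncomputable def geo {A : Type*} [Semiring A] (a : A) : PowerSeries A := PowerSeries.mk (a ^ ·)

theorem geo_mul {A : Type*} [Ring A] (a : A) :
    geo a * (1 - PowerSeries.X * PowerSeries.C a) = 1 := by
  ext e
  rw [mul_sub, mul_one, ← mul_assoc, map_sub, PowerSeries.coeff_mul_C]
  cases e with
  | zero => simp [geo]
  | succ e => simp [geo, PowerSeries.coeff_succ_mul_X, PowerSeries.coeff_one, pow_succ]

theorem coeffLow_geo (j : ℕ) : CoeffLow (j + 1) 1 (geo (X j : MvPolynomial ℕ R)) := by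
  intro e
  rw [geo, PowerSeries.coeff_mk]
  exact X_pow_mem_lowDeg j.lt_succ_self e

/-- The power series `X + q - 1`. -/
noncomputable def yS : PowerSeries (MvPolynomial ℕ R) := PowerSeries.X + ((κ (q : R)) - 1)

theorem coeffLow_yS (j : ℕ) : CoeffLow j 1 (yS q) :=
  ((coeffLow_X j).mono le_rfl (Nat.zero_le _)).add ((coeffLow_C j _).sub (coeffLow_one j))

/-- The series `q + (q - 1) Y S - Y² S²`, with `Y = X + q - 1` and `S = 1 / (1 - X_j X)`, that
relates the conditional expectations of consecutive Jucys-Murphy operators. -/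
noncomputable def gS (j : ℕ) : PowerSeries (MvPolynomial ℕ R) :=
  (κ (q : R)) + ((κ (q : R)) - 1) * yS q * geo (X j) - yS q ^ 2 * geo (X j) ^ 2

theorem coeffLow_gS (j : ℕ) : CoeffLow (j + 1) 1 (gS q j) := by
  have h1 := coeffLow_yS q (j + 1)
  have h2 := coeffLow_geo (R := R) j
  have h3 := coeffLow_C (j + 1) (q : R)
  rw [gS, pow_two, pow_two]
  exact (h3.add (((h3.sub (coeffLow_one _)).mul h1).mul h2)).sub ((h1.mul h1).mul (h2.mul h2))

theorem coeff_zero_gS (j : ℕ) : PowerSeries.coeff 0 (gS q j) = C (q : R) := by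
  simp [gS, yS, geo]
  ring

/-- The inverse of `gS`. -/
noncomputable def gInv (j : ℕ) : PowerSeries (MvPolynomial ℕ R) :=
  PowerSeries.invOfUnit (gS q j) (Units.map C.toMonoidHom q)

theorem gS_mul_gInv (j : ℕ) : gS q j * gInv q j = 1 := by
  refine PowerSeries.mul_invOfUnit _ _ ?_
  rw [← PowerSeries.coeff_zero_eq_constantCoeff_apply, coeff_zero_gS]
  rfl

theorem coeffLow_gInv (j : ℕ) : CoeffLow (j + 1) 1 (gInv q j) := by
  refine CoeffLow.of_mul q (coeff_zero_gS q j) (coeffLow_gS q j) ?_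
  rw [mul_comm, gS_mul_gInv]
  exact coeffLow_one _

/-- The generating series of the polynomials that express the conditional expectations of the powers
of the Jucys-Murphy operator `L_j` by `L_0, …, L_{j-1}`. -/
noncomputable def cS : ℕ → PowerSeries (MvPolynomial ℕ R)
  | 0 => 1
  | j + 1 => ((κ (q : R)) * cS j +
      ((κ (q : R)) - 1) * (((κ (q : R)) - 1) * geo (X j) - yS q * geo (X j) ^ 2)) * gInv q j

theorem cS_succ_mul (j : ℕ) : cS q (j + 1) * gS q j = (κ (q : R)) * cS q j +
    ((κ (q : R)) - 1) * (((κ (q : R)) - 1) * geo (X j) - yS q * geo (X j) ^ 2) := by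
  rw [cS, mul_assoc, mul_comm (gInv q j), gS_mul_gInv, mul_one]

/-- The conditional expectation of `L_j ^ e` is a polynomial of degree less than `e`, for `e > 0`.
-/
theorem coeffLow_cS_sub_one (j : ℕ) : CoeffLow j 0 (cS q j - 1) := by
  induction j with
  | zero =>
    intro e
    rw [cS, sub_self, map_zero]
    exact zero_mem _
  | succ j ih =>
    refine CoeffLow.of_mul q (coeff_zero_gS q j) (coeffLow_gS q j) ?_
    have e : (cS q (j + 1) - 1) * gS q j = (κ (q : R)) * (cS q j - 1) +
        (yS q * geo (X j) * geo (X j) - ((κ (q : R)) - 1) * geo (X j)) * PowerSeries.X := by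
      rw [sub_mul, cS_succ_mul, gS, yS]
      ring
    rw [e]
    have h1 := coeffLow_yS q (j + 1)
    have h2 := coeffLow_geo (R := R) j
    have h3 := coeffLow_C (j + 1) (q : R)
    exact (h3.mul (ih.mono j.le_succ le_rfl)).add
      ((((h1.mul h2).mul h2).sub ((h3.sub (coeffLow_one _)).mul h2)).mul (coeffLow_X _))

theorem coeffLow_cS (j : ℕ) : CoeffLow j 1 (cS q j) := by
  have := ((coeffLow_cS_sub_one q j).mono le_rfl (Nat.zero_le 1)).add (coeffLow_one j)
  rwa [sub_add_cancel] at this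

theorem coeff_succ_cS_mem (j e : ℕ) :
    PowerSeries.coeff (e + 1) (cS q j) ∈ lowDeg R j (e + 1) := by
  have := coeffLow_cS_sub_one q j (e + 1)
  rwa [map_sub, PowerSeries.coeff_one, if_neg e.succ_ne_zero, sub_zero] at this

/-- The power series with `X dS = (X + q - 1) cS - (q - 1)`, see `yS_mul_cS`. Up to terms of lower
degree it is the product `aS` that defines the polynomials `a_d`. -/
noncomputable def dS : ℕ → PowerSeries (MvPolynomial ℕ R)
  | 0 => 1
  | j + 1 => (κ (q : R)) * dS j * gInv q j

theorem dS_succ_mul (j : ℕ) : dS q (j + 1) * gS q j = (κ (q : R)) * dS q j := by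
  rw [dS, mul_assoc, mul_comm (gInv q j), gS_mul_gInv, mul_one]

theorem yS_mul_cS (j : ℕ) :
    yS q * cS q j - ((κ (q : R)) - 1) = PowerSeries.X * dS q j := by
  induction j with
  | zero =>
    rw [cS, dS, yS]
    ring
  | succ j ih =>
    have h : (yS q * cS q (j + 1) - ((κ (q : R)) - 1)) * gS q j =
        (PowerSeries.X * dS q (j + 1)) * gS q j := by
      rw [mul_assoc, dS_succ_mul, sub_mul, mul_assoc, cS_succ_mul, mul_left_comm, ← ih, gS]
      ring
    have := congrArg (· * gInv q j) h
    simpa only [mul_assoc, gS_mul_gInv, mul_one] using this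

/-- The power series `∑ s, a(s) (X_i X) ^ s`. -/
noncomputable def alphaS (i : ℕ) : PowerSeries (MvPolynomial ℕ R) :=
  PowerSeries.mk fun s => C (aCoeff q s) * X i ^ s

theorem qInt_succ (s : ℕ) : qInt q (s + 1) = (q : R) * qInt q s + ((q⁻¹ : Rˣ) : R) ^ s := by
  rw [qInt, Finset.sum_range_succ, qInt, Finset.mul_sum]
  congr 1
  · refine Finset.sum_congr rfl fun i _ => ?_
    rw [← Units.val_mul, ← zpow_one_add]
    congr 2
    push_cast
    ring
  · rw [← Units.val_pow_eq_pow_val, inv_pow, ← zpow_natCast, ← zpow_neg]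
    congr 2
    push_cast
    ring

/-- The closed form `(1 - z)² / ((1 - q z) (1 - q⁻¹ z))` of `∑ s, a(s) z ^ s`, where `z = X_i X`. -/
theorem alphaS_eq (i : ℕ) : alphaS q i = (1 - PowerSeries.X * PowerSeries.C (X i)) ^ 2 *
    geo (C (q : R) * X i) * geo (C ((q⁻¹ : Rˣ) : R) * X i) := by
  set z : PowerSeries (MvPolynomial ℕ R) := PowerSeries.X * PowerSeries.C (X i) with hz
  set Q : PowerSeries (MvPolynomial ℕ R) := PowerSeries.mk fun s => C (qInt q s) * X i ^ s with hQ
  set U := geo (C (q : R) * X i) with hU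
  set V := geo (C ((q⁻¹ : Rˣ) : R) * X i) with hV
  -- The quantum integers satisfy `[s + 1] = q [s] + q⁻¹ ^ s`, which gives `(1 - q z) Q = z V`.
  have h1 : U * (1 - (κ (q : R)) * z) = 1 := by
    have := geo_mul (C (q : R) * X i)
    rw [map_mul] at this
    rw [hU, hz]
    linear_combination this
  have h2 : V * (1 - (κ ((q⁻¹ : Rˣ) : R)) * z) = 1 := by
    have := geo_mul (C ((q⁻¹ : Rˣ) : R) * X i)
    rw [map_mul] at this
    rw [hV, hz]
    linear_combination this
  have h3 : Q * (1 - (κ (q : R)) * z) = z * V := by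
    have : Q = PowerSeries.X * (PowerSeries.C (C (q : R) * X i) * Q + PowerSeries.C (X i) * V) := by
      ext1 e
      cases e with
      | zero => simp [hQ, qInt]
      | succ e =>
        rw [PowerSeries.coeff_succ_X_mul, map_add, PowerSeries.coeff_C_mul,
          PowerSeries.coeff_C_mul, hQ, hV, geo, PowerSeries.coeff_mk, PowerSeries.coeff_mk,
          PowerSeries.coeff_mk, qInt_succ, map_add, map_mul, map_pow]
        ring
    rw [map_mul] at this
    linear_combination this
  have h4 : alphaS q i = 1 + (κ (xi q)) * Q := by
    ext1 e
    rw [alphaS, map_add, PowerSeries.coeff_C_mul, hQ, PowerSeries.coeff_mk, PowerSeries.coeff_mk,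
      PowerSeries.coeff_one]
    cases e with
    | zero => simp [aCoeff, qInt]
    | succ e =>
      rw [aCoeff, if_neg e.succ_ne_zero, if_neg e.succ_ne_zero, map_mul]
      ring
  have h5 : (κ (q : R)) * (κ ((q⁻¹ : Rˣ) : R)) = 1 := by
    rw [← map_mul, ← map_mul, Units.mul_inv, map_one, map_one]
  have h6 : (κ (xi q)) = (κ ((q⁻¹ : Rˣ) : R)) * ((κ (q : R)) - 1) ^ 2 := by
    simp [xi]
  have h7 : Q = z * V * U := by linear_combination U * h3 - Q * h1
  rw [h4, h7, h6]
  generalize (κ (q : R)) = c at *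
  generalize (κ ((q⁻¹ : Rˣ) : R)) = c' at *
  linear_combination (-1 : PowerSeries (MvPolynomial ℕ R)) * h1 * (V * (1 - c' * z)) - h2 +
    (z * V * U * (c - 2) + z ^ 2 * U * V) * h5

/-- The terms of `gS` of highest degree are inverse to `alphaS` up to the factor `q`. -/
theorem alphaS_mul (j : ℕ) : alphaS q j *
    ((κ (q : R)) + ((κ (q : R)) - 1) ^ 2 * geo (X j) - ((κ (q : R)) - 1) ^ 2 * geo (X j) ^ 2) =
    (κ (q : R)) := by
  rw [alphaS_eq]
  have h0 := geo_mul (X j : MvPolynomial ℕ R)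
  have h1 := geo_mul (C (q : R) * X j)
  have h2 := geo_mul (C ((q⁻¹ : Rˣ) : R) * X j)
  have h5 : (κ (q : R)) * (κ ((q⁻¹ : Rˣ) : R)) = 1 := by
    rw [← map_mul, ← map_mul, Units.mul_inv, map_one, map_one]
  rw [map_mul] at h1 h2
  generalize PowerSeries.C (X j : MvPolynomial ℕ R) = x at *
  generalize (κ (q : R)) = c at *
  generalize (κ ((q⁻¹ : Rˣ) : R)) = c' at *
  generalize geo (C (q : R) * X j) = U at *
  generalize geo (C ((q⁻¹ : Rˣ) : R) * X j) = V at *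
  generalize geo (X j : MvPolynomial ℕ R) = S at *
  obtain ⟨z, hz⟩ : ∃ z, z = PowerSeries.X * x := ⟨_, rfl⟩
  rw [mul_left_comm] at h1 h2
  rw [← hz] at h0 h1 h2 ⊢
  have e : (1 - z) ^ 2 * (c + (c - 1) ^ 2 * S - (c - 1) ^ 2 * S ^ 2) =
      c * (1 - z) ^ 2 - (c - 1) ^ 2 * z := by
    linear_combination ((c - 1) ^ 2 * (1 - z) - (c - 1) ^ 2 * (S * (1 - z) + 1)) * h0
  have e' : c * (1 - z) ^ 2 - (c - 1) ^ 2 * z = c * ((1 - c * z) * (1 - c' * z)) := by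
    linear_combination (z - c * z ^ 2) * h5
  rw [show (1 - z) ^ 2 * U * V * (c + (c - 1) ^ 2 * S - (c - 1) ^ 2 * S ^ 2) =
    ((1 - z) ^ 2 * (c + (c - 1) ^ 2 * S - (c - 1) ^ 2 * S ^ 2)) * (U * V) by ring, e, e']
  linear_combination c * V * (1 - c' * z) * h1 + c * h2

/-- The product over `i < j` of the power series `∑ s, a(s) (X_i X) ^ s`. -/
noncomputable def aS (j : ℕ) : PowerSeries (MvPolynomial ℕ R) := ∏ i : Fin j, alphaS q i

theorem coeffLow_alphaS (j : ℕ) : CoeffLow (j + 1) 1 (alphaS q j) := by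
  intro e
  rw [alphaS, PowerSeries.coeff_mk, C_mul']
  exact Submodule.smul_mem _ _ (X_pow_mem_lowDeg j.lt_succ_self e)

theorem aS_succ (j : ℕ) : aS q (j + 1) = aS q j * alphaS q j := by
  rw [aS, Fin.prod_univ_castSucc]
  rfl

theorem coeffLow_aS (j : ℕ) : CoeffLow j 1 (aS q j) := by
  induction j with
  | zero => simpa [aS] using coeffLow_one 0
  | succ j ih =>
    rw [aS_succ]
    exact (ih.mono j.le_succ le_rfl).mul (coeffLow_alphaS q j)

/-- Up to terms of lower degree, `dS` is the product that defines the polynomials `a_d`. -/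
theorem coeffLow_dS_sub_aS (j : ℕ) : CoeffLow j 0 (dS q j - aS q j) := by
  induction j with
  | zero =>
    intro e
    simp [dS, aS]
  | succ j ih =>
    refine CoeffLow.of_mul q (coeff_zero_gS q j) (coeffLow_gS q j) ?_
    have h := alphaS_mul q j
    have e : (dS q (j + 1) - aS q (j + 1)) * gS q j = (κ (q : R)) * (dS q j - aS q j) +
        aS q j * alphaS q j * ((PowerSeries.X + 2 * ((κ (q : R)) - 1)) * geo (X j) * geo (X j) -
          ((κ (q : R)) - 1) * geo (X j)) * PowerSeries.X := by
      rw [sub_mul, dS_succ_mul, aS_succ, gS, yS]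
      linear_combination (-aS q j) * h
    rw [e]
    have h1 := (coeffLow_X (R := R) (j + 1)).mono le_rfl (Nat.zero_le 1)
    have h2 := coeffLow_geo (R := R) j
    have h3 := (coeffLow_C (j + 1) (q : R)).sub (coeffLow_one _)
    have h4 : CoeffLow (j + 1) 1 (2 * ((κ (q : R)) - 1)) := by
      rw [two_mul]
      exact h3.add h3
    exact ((coeffLow_C (j + 1) (q : R)).mul (ih.mono j.le_succ le_rfl)).add
      (((((coeffLow_aS q j).mono j.le_succ le_rfl).mul (coeffLow_alphaS q j)).mul
        ((((h1.add h4).mul h2).mul h2).sub (h3.mul h2))).mul (coeffLow_X _))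

/-- The coefficients of `aS` are the polynomials `a_d`. -/
theorem coeff_aS (j d : ℕ) :
    PowerSeries.coeff d (aS q j) = rename ((↑) : Fin j → ℕ) (aPoly q j d) := by
  classical
  rw [aS, PowerSeries.coeff_prod, aPoly, map_sum]
  refine Finset.sum_congr rfl fun m _ => ?_
  rw [rename_monomial]
  simp only [alphaS, PowerSeries.coeff_mk, Finset.prod_mul_distrib]
  rw [← map_prod, ← rename_monomial, monomial_eq, map_mul, rename_C, Finsupp.prod_fintype _ _
    (by simp), map_prod]
  simp

end Series

/-! ### Evaluation at the Jucys-Murphy operators -/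

section Evaluation

variable {R : Type*} [CommRing R] (q : Rˣ) {n : ℕ}

theorem isMulCommutative_adjoin_jm :
    IsMulCommutative (Algebra.adjoin R (Set.range (jm R q n))) :=
  Algebra.isMulCommutative_adjoin R
    (by rintro _ ⟨i, rfl⟩ _ ⟨j, rfl⟩; exact (jm_commute q i j).eq)

open scoped IsMulCommutative in
/-- The evaluation of polynomials at the Jucys-Murphy operators. -/
noncomputable def jmEval (R : Type*) [CommRing R] (q : Rˣ) (n : ℕ) :
    MvPolynomial ℕ R →ₐ[R] Hecke R q n :=
  haveI := isMulCommutative_adjoin_jm (n := n) q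
  (Algebra.adjoin R (Set.range (jm R q n))).val.comp
    (aeval (S₁ := Algebra.adjoin R (Set.range (jm R q n)))
      fun i => ⟨jm R q n i, Algebra.subset_adjoin ⟨i, rfl⟩⟩)

open scoped IsMulCommutative in
theorem jmEval_X (i : ℕ) : jmEval R q n (X i) = jm R q n i := by
  have := isMulCommutative_adjoin_jm (n := n) q
  rw [jmEval, AlgHom.comp_apply, aeval_X]
  rfl

theorem jmEval_C (r : R) : jmEval R q n (C r) = algebraMap R _ r := by
  rw [← MvPolynomial.algebraMap_eq, AlgHom.commutes]

theorem jmEval_mem_parab {j e : ℕ} {p : MvPolynomial ℕ R} (hp : p ∈ lowDeg R (j + 1) e) :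
    jmEval R q n p ∈ parab R q n j := by
  change p ∈ (parab R q n j).comap (jmEval R q n)
  rw [p.as_sum]
  refine Subalgebra.sum_mem _ fun m hm => ?_
  rw [monomial_eq]
  refine mul_mem (Subalgebra.algebraMap_mem _ _) (Subalgebra.prod_mem _ fun i hi => pow_mem ?_ _)
  have h : i < j + 1 := (mem_lowDeg.1 hp m hm).1 hi
  rw [Subalgebra.mem_comap, jmEval_X]
  exact parab_mono q (by omega) (jm_mem_parab q i)

theorem evalAt_jucysMurphy (p : MvPolynomial (Fin n) R) :
    evalAt (jucysMurphy R q n) p = jmEval R q n (rename (↑) p) := by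
  conv_rhs => rw [p.as_sum, map_sum, map_sum]
  refine Finset.sum_congr rfl fun m _ => ?_
  rw [rename_monomial, ← mul_one (coeff m p), ← smul_eq_mul, ← smul_monomial, map_smul,
    smul_eq_mul, mul_one, ← rename_monomial, monomial_eq, map_one, one_mul,
    Finsupp.prod_fintype _ _ (by simp), ← List.prod_ofFn, map_list_prod, map_list_prod,
    List.map_ofFn, List.map_ofFn]
  congr 3
  funext i
  simp [jmEval_X, jucysMurphy_eq]

end Evaluation

/-! ### The conditional expectation of powers of Jucys-Murphy operators -/

section Expectation

variable {R : Type*} [CommRing R] (q : Rˣ) {n : ℕ}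

/-- For the series `S = 1 / (1 - x L)` and `P = 1 / (1 - x L')` of consecutive Jucys-Murphy
operators `L`, `L'` and the generator `T` between them, the product `P T` is computed by moving `T`
to the left. Here `c` is `q`. -/
theorem mul_gen_series {A : Type*} [Ring A] {T L L' S P x c : A} (hx : ∀ a, x * a = a * x)
    (hc : ∀ a, c * a = a * c) (hL : L' * T = (c - 1) * L' + 1 + T * L)
    (hS : (1 - x * L) * S = 1) (hP : P * (1 - x * L') = 1) :
    P * T = (T + (x + (c - 1)) * P - (c - 1)) * S := by
  have e1 : P * (x * L') = P - 1 := by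
    rw [mul_sub, mul_one] at hP
    rw [← hP]; abel
  have e2 : P * T * (x * L) = (P - 1) * T - (c - 1) * (P - 1) - x * P := by
    have h1 : T * L = L' * T - (c - 1) * L' - 1 := by rw [hL]; abel
    have h2 : ∀ a, (c - 1) * a = a * (c - 1) := fun a => by rw [sub_mul, mul_sub, hc]; simp
    calc P * T * (x * L) = P * (x * (T * L)) := by
          rw [mul_assoc, ← mul_assoc T x, ← hx T, mul_assoc x]
      _ = P * (x * L') * T - (P * (x * L')) * (c - 1) - P * x := by
          rw [h1, h2 L']; noncomm_ring
      _ = _ := by rw [e1, ← h2, hx P]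
  calc P * T = P * T * ((1 - x * L) * S) := by rw [hS, mul_one]
    _ = (P * T - P * T * (x * L)) * S := by noncomm_ring
    _ = _ := by rw [e2]; congr 1; noncomm_ring

/-- The product `T S T` agrees with a combination of `P` and `S` without factors `T`, up to terms
with a single factor `T`. The conditional expectation kills the latter. -/
theorem gen_series_gen {A : Type*} [Ring A] {T S P y c : A} (hy : ∀ a, y * a = a * y)
    (hc : ∀ a, c * a = a * c) (hT : T * T = (c - 1) * T + c) (hPS : P * S = S * P)
    (hPT : P * T = (T + y * P - (c - 1)) * S) :
    T * S * T - (c * P + (c - 1) * y * P * S - (c - 1) * (c - 1) * S - y * y * P * S * S +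
      (c - 1) * y * S * S) =
      (c - 1) * (T * S) - y * (S * (T * S)) + (c - 1) * (S * T) := by
  have h2 : ∀ a, a * (c - 1) = (c - 1) * a := fun a => by rw [sub_mul, mul_sub, hc]; simp
  have e1 : T * S = P * T - y * (P * S) + (c - 1) * S := by rw [hPT]; noncomm_ring
  have e2 : T * S * T = P * (T * T) - y * (S * (P * T)) + (c - 1) * (S * T) := by
    rw [e1, hPS]; noncomm_ring
  have e3 : P * (T * T) = (c - 1) * (P * T) + c * P := by
    rw [hT, mul_add, ← mul_assoc, h2, mul_assoc, hc P]
  have e4 : S * (y * P * S) = y * P * S * S := by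
    rw [mul_assoc y, ← mul_assoc S, ← hy S, mul_assoc y, ← mul_assoc S, ← hPS]
    noncomm_ring
  have e5 : S * (P * T) = S * (T * S) + y * P * S * S - (c - 1) * (S * S) := by
    rw [hPT, ← e4, sub_mul, add_mul, mul_sub, mul_add, ← mul_assoc S (c - 1), h2]
    noncomm_ring
  rw [e2, e3, e5, hPT]
  have e6 : y * ((c - 1) * (S * S)) = (c - 1) * y * S * S := by
    rw [← mul_assoc, hy]; noncomm_ring
  rw [mul_sub, e6]
  noncomm_ring

/-- The power series with coefficients in `expKer`. -/
def SeriesKer (R : Type*) [CommRing R] (q : Rˣ) (n j : ℕ) (F : PowerSeries (Hecke R q n)) : Prop :=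
  ∀ e, PowerSeries.coeff e F ∈ expKer R q n j

/-- The power series with coefficients in `parab`. -/
def SeriesParab (R : Type*) [CommRing R] (q : Rˣ) (n j : ℕ) (F : PowerSeries (Hecke R q n)) :
    Prop :=
  ∀ e, PowerSeries.coeff e F ∈ parab R q n j

variable {q}

theorem SeriesKer.add {j : ℕ} {F G : PowerSeries (Hecke R q n)} (hF : SeriesKer R q n j F)
    (hG : SeriesKer R q n j G) : SeriesKer R q n j (F + G) :=
  fun e => by rw [map_add]; exact add_mem (hF e) (hG e)

theorem SeriesKer.sub {j : ℕ} {F G : PowerSeries (Hecke R q n)} (hF : SeriesKer R q n j F)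
    (hG : SeriesKer R q n j G) : SeriesKer R q n j (F - G) :=
  fun e => by rw [map_sub]; exact sub_mem (hF e) (hG e)

theorem SeriesKer.mul_left {j : ℕ} {F G : PowerSeries (Hecke R q n)} (hF : SeriesParab R q n j F)
    (hG : SeriesKer R q n j G) : SeriesKer R q n j (F * G) := by
  intro e
  rw [PowerSeries.coeff_mul]
  exact Submodule.sum_mem _ fun p _ => mul_mem_expKer q (hF _) (hG _)

theorem SeriesKer.mul_right {j : ℕ} {F G : PowerSeries (Hecke R q n)} (hF : SeriesParab R q n j F)
    (hG : SeriesKer R q n j G) : SeriesKer R q n j (G * F) := by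
  intro e
  rw [PowerSeries.coeff_mul]
  exact Submodule.sum_mem _ fun p _ => expKer_mul_mem q (hF _) (hG _)

variable (q)

/-- The coefficientwise evaluation of polynomials at the Jucys-Murphy operators. -/
noncomputable def jmSeries (R : Type*) [CommRing R] (q : Rˣ) (n : ℕ) :
    PowerSeries (MvPolynomial ℕ R) →+* PowerSeries (Hecke R q n) :=
  PowerSeries.map (jmEval R q n : MvPolynomial ℕ R →+* Hecke R q n)

theorem coeff_jmSeries (F : PowerSeries (MvPolynomial ℕ R)) (e : ℕ) :
    PowerSeries.coeff e (jmSeries R q n F) = jmEval R q n (PowerSeries.coeff e F) :=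
  PowerSeries.coeff_map _ _ _

theorem seriesParab_jmSeries {j s : ℕ} {F : PowerSeries (MvPolynomial ℕ R)}
    (hF : CoeffLow (j + 1) s F) : SeriesParab R q n j (jmSeries R q n F) := by
  intro e
  rw [coeff_jmSeries]
  exact jmEval_mem_parab q (hF e)

theorem seriesKer_gen (j : ℕ) : SeriesKer R q n j (PowerSeries.C (gen R q n j)) := by
  intro e
  rw [PowerSeries.coeff_C]
  split_ifs
  · simpa using mul_gen_mul_mem_expKer q (one_mem (parab R q n j)) (one_mem (parab R q n j))
  · exact zero_mem _

theorem jmSeries_X : jmSeries R q n PowerSeries.X = PowerSeries.X := PowerSeries.map_X _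

theorem jmSeries_C (p : MvPolynomial ℕ R) :
    jmSeries R q n (PowerSeries.C p) = PowerSeries.C (jmEval R q n p) := PowerSeries.map_C _ _

theorem X_central (F : PowerSeries (Hecke R q n)) :
    PowerSeries.X * F = F * PowerSeries.X := (PowerSeries.commute_X F).eq.symm

theorem jmSeries_C_central (r : R) (F : PowerSeries (Hecke R q n)) :
    jmSeries R q n (PowerSeries.C (C r)) * F = F * jmSeries R q n (PowerSeries.C (C r)) := by
  ext1 e
  rw [jmSeries_C, PowerSeries.coeff_C_mul, PowerSeries.coeff_mul_C, jmEval_C, Algebra.commutes]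

theorem yS_central (F : PowerSeries (Hecke R q n)) :
    jmSeries R q n (yS q) * F = F * jmSeries R q n (yS q) := by
  rw [yS, map_add, map_sub, map_one, jmSeries_X, add_mul, mul_add, sub_mul, mul_sub, X_central,
    jmSeries_C_central, one_mul, mul_one]

theorem geo_jm_mul_gen {j : ℕ} (hj : j < n - 1) :
    jmSeries R q n (geo (X (j + 1))) * PowerSeries.C (gen R q n j) =
      (PowerSeries.C (gen R q n j) + jmSeries R q n (yS q) * jmSeries R q n (geo (X (j + 1))) -
        (jmSeries R q n (PowerSeries.C (C (q : R))) - 1)) * jmSeries R q n (geo (X j)) := by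
  have h : jmSeries R q n (yS q) =
      PowerSeries.X + (jmSeries R q n (PowerSeries.C (C (q : R))) - 1) := by
    rw [yS, map_add, map_sub, map_one, jmSeries_X]
  rw [h]
  refine mul_gen_series (L := PowerSeries.C (jm R q n j)) (L' := PowerSeries.C (jm R q n (j + 1)))
    (X_central q) (jmSeries_C_central q _) ?_ ?_ ?_
  · rw [← map_mul, jm_succ_mul_gen q hj, map_add, map_add, map_mul, map_one, Algebra.smul_def,
      map_sub, map_one, sub_mul, one_mul, map_sub, map_mul, jmSeries_C, jmEval_C, sub_mul, one_mul]
  · have := congrArg (jmSeries R q n) (geo_mul (X j : MvPolynomial ℕ R))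
    rw [mul_comm] at this
    simpa only [map_mul, map_sub, map_one, jmSeries_X, jmSeries_C, jmEval_X] using this
  · have := congrArg (jmSeries R q n) (geo_mul (X (j + 1) : MvPolynomial ℕ R))
    simpa only [map_mul, map_sub, map_one, jmSeries_X, jmSeries_C, jmEval_X] using this

/-- The inductive step for the computation of the conditional expectation of the powers of the
Jucys-Murphy operators: if `g_j S g_j` is congruent to `q cS_j`, where `S = 1 / (1 - L_j X)`, then
`gen_series_gen` is a linear equation for `1 / (1 - L_{j+1} X)` modulo `expKer`, with solution
`cS_{j+1}`. -/
theorem seriesKer_geo_sub_cS_of {j : ℕ} (hj : j < n - 1)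
    (h : SeriesKer R q n j (PowerSeries.C (gen R q n j) * jmSeries R q n (geo (X j)) *
      PowerSeries.C (gen R q n j) - jmSeries R q n (PowerSeries.C (C (q : R)) * cS q j))) :
    SeriesKer R q n j (jmSeries R q n (geo (X (j + 1)) - cS q (j + 1))) := by
  have hT := seriesKer_gen (R := R) (n := n) q j
  have hPT := geo_jm_mul_gen (R := R) q hj
  have hS := seriesParab_jmSeries (n := n) q (coeffLow_geo (R := R) j)
  have hy := seriesParab_jmSeries (n := n) q (coeffLow_yS q (j + 1))
  have hc := seriesParab_jmSeries (n := n) q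
    ((coeffLow_C (j + 1) (q : R)).sub (coeffLow_one (j + 1)))
  have h1 := gen_series_gen (yS_central q) (jmSeries_C_central q _)
    (by
      rw [← map_mul, gen_sq q hj, map_add, Algebra.smul_def, Algebra.smul_def, mul_one,
        map_sub, map_one, sub_mul, one_mul, map_sub, map_mul, jmSeries_C, jmEval_C, sub_mul,
        one_mul])
    (by rw [← map_mul, ← map_mul, mul_comm]) hPT
  have h2 : SeriesKer R q n j
      (jmSeries R q n ((geo (X (j + 1)) - cS q (j + 1)) * gS q j)) := by
    have hk := ((hT.mul_right hS).mul_left hc).sub (((hT.mul_right hS).mul_left hS).mul_left hy)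
      |>.add ((hT.mul_left hS).mul_left hc)
    rw [map_sub, map_one, ← h1] at hk
    have e : jmSeries R q n ((geo (X (j + 1)) - cS q (j + 1)) * gS q j) = _ :=
      congrArg (jmSeries R q n) (by rw [sub_mul, cS_succ_mul])
    rw [e]
    refine Eq.mp (congrArg _ ?_) (h.sub hk)
    rw [sub_sub_sub_cancel_left, gS]
    simp only [map_sub, map_add, map_mul, map_one, map_pow]
    simp only [← map_one (jmSeries R q n), ← map_sub, ← map_mul, ← map_add, ← map_pow]
    congr 1
    ring
  have h3 := h2.mul_right (seriesParab_jmSeries (n := n) q (coeffLow_gInv q j))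
  rwa [← map_mul, mul_assoc, gS_mul_gInv, mul_one] at h3

/-- Modulo the kernel of the conditional expectation, the powers of a Jucys-Murphy operator are
polynomials in the preceding Jucys-Murphy operators. -/
theorem seriesKer_geo_sub_cS {j : ℕ} (hj : j < n - 1) :
    SeriesKer R q n j (jmSeries R q n (geo (X (j + 1)) - cS q (j + 1))) := by
  induction j with
  | zero =>
    refine seriesKer_geo_sub_cS_of q hj fun e => ?_
    rw [map_sub, PowerSeries.coeff_mul_C, PowerSeries.coeff_C_mul, coeff_jmSeries, coeff_jmSeries,
      cS, mul_one, PowerSeries.coeff_C, geo, PowerSeries.coeff_mk, map_pow, jmEval_X]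
    cases e with
    | zero =>
      rw [pow_zero, mul_one, gen_sq q hj, if_pos rfl, jmEval_C, Algebra.algebraMap_eq_smul_one,
        add_sub_cancel_right]
      refine Submodule.smul_mem _ _ ?_
      simpa using mul_gen_mul_mem_expKer q (one_mem (parab R q n 0)) (one_mem (parab R q n 0))
    | succ e => simp [jm]
  | succ j ih =>
    refine seriesKer_geo_sub_cS_of q hj fun e => ?_
    have h1 := ih (by omega) e
    rw [map_sub, PowerSeries.coeff_mul_C, PowerSeries.coeff_C_mul, coeff_jmSeries, coeff_jmSeries,
      PowerSeries.coeff_C_mul, map_mul, jmEval_C]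
    rw [coeff_jmSeries, map_sub, map_sub] at h1
    have h2 := gen_mul_expKer_mul_gen q h1
    have h3 := jmEval_mem_parab (n := n) q (coeffLow_cS q (j + 1) e)
    generalize jmEval R q n (PowerSeries.coeff e (geo (X (j + 1)))) = u at *
    generalize jmEval R q n (PowerSeries.coeff e (cS q (j + 1))) = v at *
    have h4 := (gen_commute_parab q h3).eq
    have e1 : gen R q n (j + 1) * u * gen R q n (j + 1) - algebraMap R _ (q : R) * v =
        gen R q n (j + 1) * (u - v) * gen R q n (j + 1) +
          ((q : R) - 1) • (v * gen R q n (j + 1) * 1) := by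
      rw [mul_sub, sub_mul, h4, mul_assoc v, gen_sq q hj, ← Algebra.smul_def]
      simp only [mul_add, mul_smul_comm, mul_one]
      module
    rw [e1]
    exact add_mem h2 (Submodule.smul_mem _ _
      (mul_gen_mul_mem_expKer q (parab_mono q j.le_succ h3) (one_mem _)))

theorem jm_pow_sub_mem_expKer {j : ℕ} (hj : j < n - 1) (e : ℕ) :
    jmEval R q n (X (j + 1) ^ e) - jmEval R q n (PowerSeries.coeff e (cS q (j + 1))) ∈
      expKer R q n j := by
  have := seriesKer_geo_sub_cS (R := R) q hj e
  rwa [coeff_jmSeries, map_sub, map_sub, geo, PowerSeries.coeff_mk] at this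

/-- The conditional expectation of `L_{j+1} ^ e g_j` is the coefficient at `X ^ e` of the series
`X dS / (1 - L_j X)`. -/
theorem jm_pow_mul_gen_sub_mem_expKer {j : ℕ} (hj : j < n - 1) (e : ℕ) :
    jmEval R q n (X (j + 1) ^ e) * gen R q n j - jmEval R q n
      (PowerSeries.coeff e (PowerSeries.X * dS q (j + 1) * geo (X j))) ∈ expKer R q n j := by
  have h : SeriesKer R q n j (jmSeries R q n (geo (X (j + 1))) * PowerSeries.C (gen R q n j) -
      jmSeries R q n (PowerSeries.X * dS q (j + 1) * geo (X j))) := by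
    have hS := seriesParab_jmSeries (n := n) q (coeffLow_geo (R := R) j)
    have hy := seriesParab_jmSeries (n := n) q (coeffLow_yS q (j + 1))
    have h1 := ((seriesKer_gen (R := R) (n := n) q j).mul_right hS).add
      (((seriesKer_geo_sub_cS (R := R) q hj).mul_right hS).mul_left hy)
    refine Eq.mp (congrArg _ ?_) h1
    rw [geo_jm_mul_gen q hj, ← yS_mul_cS]
    simp only [map_sub, map_mul, mul_sub, sub_mul, add_mul, one_mul, mul_assoc]
    abel
  have := h e
  rwa [map_sub, PowerSeries.coeff_mul_C, coeff_jmSeries, coeff_jmSeries, geo,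
    PowerSeries.coeff_mk] at this

end Expectation

/-! ### Pairings with increasing words -/

section Pairing

variable {R : Type*} [CommRing R] (q : Rˣ) {n : ℕ}

/-- The product `g_{f 0} ⋯ g_{f (k - 1)}` of generators. -/
noncomputable def genWord (R : Type*) [CommRing R] (q : Rˣ) (n : ℕ) (f : ℕ → ℕ) : ℕ → Hecke R q n
  | 0 => 1
  | k + 1 => genWord R q n f k * gen R q n (f k)

theorem genWord_mem_parab {f : ℕ → ℕ} {j k : ℕ} (h : ∀ x < k, f x < j) :
    genWord R q n f k ∈ parab R q n j := by
  induction k with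
  | zero => exact one_mem _
  | succ k ih =>
    exact mul_mem (ih fun x hx => h x (by omega)) (gen_mem_parab q (h k (by omega)))

/-- The pairing of the word `g_{f 0} ⋯ g_{f (k - 1)}` with a polynomial in the Jucys-Murphy
operators. -/
noncomputable def pairing (R : Type*) [CommRing R] (q : Rˣ) (n : ℕ) (f : ℕ → ℕ) (k : ℕ) :
    MvPolynomial ℕ R →ₗ[R] R :=
  ((traceLin q).comp (LinearMap.mulRight R (genWord R q n f k))).comp (jmEval R q n).toLinearMap

theorem pairing_apply (f : ℕ → ℕ) (k : ℕ) (p : MvPolynomial ℕ R) :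
    pairing R q n f k p = traceLin q (jmEval R q n p * genWord R q n f k) := rfl

/-- The last letter of the word has to be matched by a Jucys-Murphy operator that involves it. -/
theorem pairing_succ_eq_zero {f : ℕ → ℕ} {k e : ℕ} (hf : ∀ x < k, f x < f k)
    {p : MvPolynomial ℕ R} (hp : p ∈ lowDeg R (f k + 1) e) : pairing R q n f (k + 1) p = 0 := by
  rw [pairing_apply, genWord, ← mul_assoc]
  exact traceLin_mul_gen q (mul_mem (jmEval_mem_parab q hp) (genWord_mem_parab q hf))

theorem pairing_succ_mul_X_pow {f : ℕ → ℕ} {k a : ℕ} (hf : ∀ x < k, f x < f k)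
    (hn : f k < n - 1) {p : MvPolynomial ℕ R} (hp : p ∈ lowDeg R (f k + 1) a) (e : ℕ) :
    pairing R q n f (k + 1) (p * X (f k + 1) ^ e) = pairing R q n f k
      (p * PowerSeries.coeff e (PowerSeries.X * dS q (f k + 1) * geo (X (f k)))) := by
  have hW := genWord_mem_parab (R := R) (n := n) q hf
  have hp' := jmEval_mem_parab (n := n) q hp
  set b := PowerSeries.coeff e (PowerSeries.X * dS q (f k + 1) * geo (X (f k))) with hb_def
  have hb : b ∈ lowDeg R (f k + 1) (e + 1) := by
    have h1 := ((coeffLow_dS_sub_aS q (f k + 1)).mono le_rfl (Nat.zero_le 1)).add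
      (coeffLow_aS q (f k + 1))
    rw [sub_add_cancel] at h1
    exact (((coeffLow_X _).mono le_rfl (Nat.zero_le 1)).mul h1).mul (coeffLow_geo _) e
  have hb' := jmEval_mem_parab (n := n) q hb
  have hK := traceLin_expKer q
    (mul_mem_expKer q (mul_mem hp' hW) (jm_pow_mul_gen_sub_mem_expKer (R := R) q hn e))
  have hc : Commute (jmEval R q n (X (f k + 1) ^ e)) (genWord R q n f k) := by
    rw [map_pow, jmEval_X]
    exact (jm_succ_commute_parab q hW).pow_left e
  rw [← hb_def, mul_sub, map_sub, sub_eq_zero, ← traceLin_comm_of_mem q hb'] at hK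
  rw [pairing_apply, pairing_apply, mul_comm p b, map_mul _ b, mul_assoc (jmEval R q n b), ← hK,
    map_mul (jmEval R q n) p, genWord, mul_assoc, ← mul_assoc _ _ (gen R q n (f k)), hc.eq]
  simp only [mul_assoc]

theorem pairing_mul_X_pow {f : ℕ → ℕ} {j k a : ℕ} (hf : ∀ x < k, f x < j)
    (hn : j < n - 1) {p : MvPolynomial ℕ R} (hp : p ∈ lowDeg R (j + 1) a) (e : ℕ) :
    pairing R q n f k (p * X (j + 1) ^ e) =
      pairing R q n f k (p * PowerSeries.coeff e (cS q (j + 1))) := by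
  have hK := traceLin_expKer q (expKer_mul_mem q (genWord_mem_parab (R := R) (n := n) q hf)
    (mul_mem_expKer q (jmEval_mem_parab (n := n) q hp) (jm_pow_sub_mem_expKer (R := R) q hn e)))
  rw [mul_sub, sub_mul, map_sub, sub_eq_zero, ← map_mul, ← map_mul] at hK
  exact hK

theorem jmEval_mul_X_pow_eq_zero {j : ℕ} (h : ¬ j < n - 1) (p : MvPolynomial ℕ R) (e : ℕ) :
    jmEval R q n (p * X (j + 1) ^ (e + 1)) = 0 := by
  rw [map_mul, map_pow, jmEval_X, jm_succ_eq_zero q h, zero_pow e.succ_ne_zero, mul_zero]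

/-- Induction on polynomials in `j + 1` variables that splits off the powers of the last variable.
-/
theorem lowDeg_succ_induction {j e : ℕ} {P : MvPolynomial ℕ R → Prop} (zero : P 0)
    (add : ∀ p r, P p → P r → P (p + r))
    (mul : ∀ a s, a + s = e → ∀ r ∈ lowDeg R j a, P (r * X j ^ s)) {p : MvPolynomial ℕ R}
    (hp : p ∈ lowDeg R (j + 1) e) : P p := by
  have hs := mem_lowDeg.1 hp
  rw [p.as_sum]
  refine Finset.sum_induction _ P (fun _ _ => add _ _) zero fun m hm => ?_
  obtain ⟨h1, h2⟩ := hs m hm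
  have e1 : m.erase j + Finsupp.single j (m j) = m := Finsupp.erase_add_single j m
  have e2 : (m.erase j).degree + m j = m.degree := by
    conv_rhs => rw [← e1, map_add, Finsupp.degree_single]
  have e3 : monomial m (coeff m p) = monomial (m.erase j) (coeff m p) * X j ^ m j := by
    rw [X_pow_eq_monomial, monomial_mul, mul_one, e1]
  rw [e3]
  refine mul (e - m j) (m j) (by omega) _ (monomial_mem_lowDeg (fun i hi => ?_) (by omega) _)
  have h3 := Finsupp.support_erase (f := m) (a := j) ▸ Finset.mem_coe.1 hi
  rw [Finset.mem_erase] at h3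
  have h4 : i < j + 1 := h1 h3.2
  have h5 := h3.1
  show i < j
  omega

theorem cS_mul_mem_lowDeg {j a e : ℕ} {p : MvPolynomial ℕ R} (hp : p ∈ lowDeg R (j + 1) a) :
    p * PowerSeries.coeff (e + 1) (cS q (j + 1)) ∈ lowDeg R (j + 1) (e + a) := by
  rw [mul_comm]
  exact mul_mem_lowDeg (coeff_succ_cS_mem q (j + 1) e) hp

/-- An increasing word of length `k` pairs to zero with the polynomials of degree less than `k`. The
conditional expectation replaces a power of the last variable by a polynomial of lower degree; it
also removes the last letter of the word if the variable is the first one that involves it. -/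
theorem pairing_eq_zero {f : ℕ → ℕ} {k : ℕ} (hf : StrictMonoOn f (Set.Iio k))
    (hn : ∀ x < k, f x < n - 1) {j : ℕ} {p : MvPolynomial ℕ R} (hp : p ∈ lowDeg R j k) :
    pairing R q n f k p = 0 := by
  induction k generalizing j p with
  | zero => rw [eq_zero_of_mem_lowDeg hp, map_zero]
  | succ k ih =>
    have ih := fun (j : ℕ) (p : MvPolynomial ℕ R) => @ih
      (hf.mono (Set.Iio_subset_Iio k.le_succ)) (fun x hx => hn x (by omega)) j p
    have hf' : ∀ x < k, f x < f k := fun x hx =>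
      hf (show x < k + 1 by omega) (show k < k + 1 by omega) hx
    have hk := hn k (by omega)
    induction j generalizing p with
    | zero => exact pairing_succ_eq_zero q hf' (lowDeg_mono (Nat.zero_le _) le_rfl hp)
    | succ j ihj =>
      by_cases hj : j ≤ f k
      · exact pairing_succ_eq_zero q hf' (lowDeg_mono (by omega) le_rfl hp)
      obtain ⟨i, rfl⟩ : ∃ i, j = i + 1 := ⟨j - 1, by omega⟩
      refine lowDeg_succ_induction (P := fun p => pairing R q n f (k + 1) p = 0) (map_zero _)
        (fun p r hp hr => ?_) ?_ hp
      · rw [map_add, hp, hr, add_zero]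
      rintro a (_ | s) has r hr
      · rw [pow_zero, mul_one]
        rw [add_zero] at has
        exact ihj (has ▸ hr)
      by_cases hi : i < n - 1
      · by_cases hik : i = f k
        · subst hik
          rw [pairing_succ_mul_X_pow q hf' hk hr]
          refine ih (f k + 1) _ ?_
          have h1 := ((coeffLow_dS_sub_aS q (f k + 1)).mono le_rfl (Nat.zero_le 1)).add
            (coeffLow_aS q (f k + 1))
          rw [sub_add_cancel] at h1
          have h2 := (h1.mul (coeffLow_geo _)).mul (coeffLow_X (R := R) _) (s + 1)
          rw [mul_comm _ PowerSeries.X, ← mul_assoc] at h2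
          have h3 := mul_mem_lowDeg h2 hr
          rw [mul_comm] at h3
          exact lowDeg_mono le_rfl (by omega) h3
        · rw [pairing_mul_X_pow q (j := i) (fun x hx => ?_) hi hr]
          · exact ihj (lowDeg_mono le_rfl (by omega) (cS_mul_mem_lowDeg q hr))
          · rcases Nat.lt_succ_iff_lt_or_eq.1 hx with h | rfl
            · have := hf' x h
              omega
            · omega
      · rw [pairing_apply, jmEval_mul_X_pow_eq_zero q hi, zero_mul, map_zero]

/-- Monomials of degree at most `k` with a variable beyond the letters of the word do not
contribute, since the conditional expectation of a power has lower degree. -/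
theorem pairing_mul_X_pow_eq_zero {f : ℕ → ℕ} {j k a e : ℕ} (hf : StrictMonoOn f (Set.Iio k))
    (hn : ∀ x < k, f x < n - 1) (hj : ∀ x < k, f x < j) {p : MvPolynomial ℕ R}
    (hp : p ∈ lowDeg R (j + 1) a) (hk : a + e ≤ k) :
    pairing R q n f k (p * X (j + 1) ^ (e + 1)) = 0 := by
  by_cases hjn : j < n - 1
  · rw [pairing_mul_X_pow q hj hjn hp]
    exact pairing_eq_zero q hf hn (lowDeg_mono le_rfl (by omega) (cS_mul_mem_lowDeg q hp))
  · rw [pairing_apply, jmEval_mul_X_pow_eq_zero q hjn, zero_mul, map_zero]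

/-- In top degree, the last letter of an increasing word can be removed. -/
theorem pairing_succ_mul_X_pow_succ {f : ℕ → ℕ} {k a e : ℕ}
    (hf : StrictMonoOn f (Set.Iio (k + 1))) (hn : ∀ x < k + 1, f x < n - 1) {p : MvPolynomial ℕ R}
    (hp : p ∈ lowDeg R (f k + 1) (a + 1)) (hk : a + e ≤ k) :
    pairing R q n f (k + 1) (p * X (f k + 1) ^ (e + 1)) =
      pairing R q n f k (p * PowerSeries.coeff e (aS q (f k + 1) * geo (X (f k)))) := by
  have hf' : ∀ x < k, f x < f k := fun x hx =>
    hf (show x < k + 1 by omega) (show k < k + 1 by omega) hx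
  rw [pairing_succ_mul_X_pow q hf' (hn k (by omega)) hp, mul_assoc, PowerSeries.coeff_succ_X_mul,
    ← sub_eq_zero, ← map_sub, ← mul_sub, ← map_sub, ← sub_mul]
  refine pairing_eq_zero q (hf.mono (Set.Iio_subset_Iio k.le_succ)) (fun x hx => hn x (by omega))
    (j := f k + 1) (lowDeg_mono le_rfl hk (mul_mem_lowDeg hp ?_))
  have := (coeffLow_geo (f k)).mul (coeffLow_dS_sub_aS q (f k + 1)) e
  rwa [mul_comm] at this

end Pairing

/-! ### Monomial quasi-symmetric polynomials -/

section QuasiSymmetric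

variable {R : Type*} [CommRing R]

/-- The monomial quasi-symmetric polynomials in the first `N` variables, defined by recursion on
`N`. The composition is given by the list of its parts in reverse order. -/
noncomputable def qs (R : Type*) [CommRing R] : ℕ → List ℕ → MvPolynomial ℕ R
  | _, [] => 1
  | 0, _ :: _ => 0
  | N + 1, e :: l => qs R N (e :: l) + qs R N l * X N ^ e

theorem qs_nil (N : ℕ) : qs R N [] = 1 := by
  cases N <;> rfl

theorem qs_succ_cons (N e : ℕ) (l : List ℕ) :
    qs R (N + 1) (e :: l) = qs R N (e :: l) + qs R N l * X N ^ e := rfl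

theorem qs_mem_lowDeg (N : ℕ) (l : List ℕ) : qs R N l ∈ lowDeg R N (l.sum + 1) := by
  induction N generalizing l with
  | zero =>
    cases l with
    | nil => exact one_mem_lowDeg _ _
    | cons e l => exact zero_mem _
  | succ N ih =>
    cases l with
    | nil => exact one_mem_lowDeg _ _
    | cons e l =>
      refine add_mem (lowDeg_mono N.le_succ le_rfl (ih _)) ?_
      have := mul_mem_lowDeg (lowDeg_mono N.le_succ le_rfl (ih l))
        (X_pow_mem_lowDeg (R := R) N.lt_succ_self e)
      rwa [List.sum_cons, add_comm e, add_assoc]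

/-- The non-zero exponents among the first `N`, in reverse order. -/
def expList (a : ℕ →₀ ℕ) : ℕ → List ℕ
  | 0 => []
  | N + 1 => if a N = 0 then expList a N else a N :: expList a N

theorem expList_congr {a b : ℕ →₀ ℕ} {N : ℕ} (h : ∀ i < N, a i = b i) :
    expList a N = expList b N := by
  induction N with
  | zero => rfl
  | succ N ih => rw [expList, expList, h N (by omega), ih fun i hi => h i (by omega)]

theorem coeff_qs (N : ℕ) {l : List ℕ} (hl : ∀ e ∈ l, 0 < e) {a : ℕ →₀ ℕ}
    (ha : ↑a.support ⊆ Set.Iio N) :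
    coeff a (qs R N l) = if expList a N = l then 1 else 0 := by
  classical
  induction N generalizing l a with
  | zero =>
    have h0 : a = 0 := by
      rw [← Finsupp.support_eq_empty, ← Finset.coe_eq_empty]
      exact Set.subset_empty_iff.1 (ha.trans (by simp))
    subst h0
    cases l <;> simp [qs, expList]
  | succ N ih =>
    cases l with
    | nil =>
      rw [qs_nil, coeff_one]
      refine if_congr ?_ rfl rfl
      have h1 : ∀ M, expList a M = [] ↔ ∀ i < M, a i = 0 := by
        intro M
        induction M with
        | zero => simp [expList]
        | succ M ih =>
          rw [expList]
          split_ifs with h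
          · rw [ih]
            refine ⟨fun h' i hi => ?_, fun h' i hi => h' i (by omega)⟩
            rcases Nat.lt_succ_iff_lt_or_eq.1 hi with h'' | rfl
            · exact h' i h''
            · exact h
          · rw [false_iff]
            exact fun hc => h (hc M (by omega))
      rw [h1]
      constructor
      · rintro rfl
        simp
      · intro h
        ext i
        by_cases hi : i < N + 1
        · exact (h i hi).symm
        · rw [Finsupp.zero_apply]
          by_contra hc
          exact hi (ha (Finset.mem_coe.2 (Finsupp.mem_support_iff.2 (Ne.symm hc))))
    | cons e l =>
      have he := hl e List.mem_cons_self
      rw [qs_succ_cons, coeff_add, X_pow_eq_monomial, coeff_mul_monomial', mul_one, expList]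
      by_cases h0 : a N = 0
      · rw [if_neg, add_zero, if_pos h0, ih hl]
        · intro i hi
          have h1 : i < N + 1 := ha hi
          have h2 : i ≠ N := by
            rintro rfl
            exact Finsupp.mem_support_iff.1 hi h0
          show i < N
          omega
        · intro hc
          have := hc N
          rw [Finsupp.single_eq_same] at this
          omega
      · rw [if_neg h0]
        have hz : coeff a (qs R N (e :: l)) = 0 := by
          by_contra hc
          have this : N < N := (mem_lowDeg.1 (qs_mem_lowDeg N (e :: l)) a (mem_support_iff.2 hc)).1
            (Finset.mem_coe.2 (Finsupp.mem_support_iff.2 h0))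
          exact lt_irrefl _ this
        rw [hz, zero_add]
        by_cases h1 : a N = e
        · have h2 : Finsupp.single N e ≤ a := by
            rw [Finsupp.single_le_iff]
            exact h1.ge
          have h3 : ∀ i, (a - Finsupp.single N e) i = if i = N then 0 else a i := by
            intro i
            rw [Finsupp.tsub_apply, Finsupp.single_apply]
            by_cases hi : i = N
            · subst hi; simp [h1]
            · simp [hi, Ne.symm hi]
          rw [if_pos h2, ih fun x hx => hl x (List.mem_cons_of_mem _ hx)]
          · rw [expList_congr (b := a) fun i hi => by rw [h3, if_neg hi.ne], h1]
            simp
          · intro i hi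
            have h4 := Finsupp.mem_support_iff.1 (Finset.mem_coe.1 hi)
            rw [h3] at h4
            have h5 : i ≠ N := fun h => h4 (if_pos h)
            rw [if_neg h5] at h4
            have h6 : i < N + 1 := ha (Finset.mem_coe.2 (Finsupp.mem_support_iff.2 h4))
            show i < N
            omega
        · rw [if_neg (show ¬ (a N :: expList a N = e :: l) by simp [h1])]
          split_ifs with h2
          · rw [Finsupp.single_le_iff] at h2
            by_contra hc
            have h3 := (mem_lowDeg.1 (qs_mem_lowDeg N l) _ (mem_support_iff.2 hc)).1
            have h4 : N ∈ (a - Finsupp.single N e).support := by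
              rw [Finsupp.mem_support_iff, Finsupp.tsub_apply, Finsupp.single_eq_same]
              omega
            have h5 : N < N := h3 (Finset.mem_coe.2 h4)
            exact lt_irrefl _ h5
          · rfl

theorem expList_eq (a : ℕ →₀ ℕ) (N : ℕ) :
    expList a N = (((List.range N).filter (a · ≠ 0)).map a).reverse := by
  induction N with
  | zero => rfl
  | succ N ih =>
    rw [expList, List.range_succ, List.filter_append, List.map_append, List.reverse_append, ih]
    by_cases h : a N = 0 <;> simp [h]

theorem expList_mapDomain {m N : ℕ} {e : Fin m → ℕ} (he : StrictMono e) (hN : ∀ i, e i < N)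
    {b : Fin m →₀ ℕ} (hb : ∀ i, b i ≠ 0) :
    expList (b.mapDomain e) N = (List.ofFn b).reverse := by
  rw [expList_eq]
  congr 1
  have h : (List.range N).filter (b.mapDomain e · ≠ 0) = List.ofFn e := by
    refine List.Perm.eq_of_pairwise (le := (· < ·)) (fun a b _ _ h1 h2 => absurd h1 h2.asymm) ?_ ?_
      ((List.perm_ext_iff_of_nodup ?_ ?_).2 ?_)
    · exact List.pairwise_lt_range.filter _
    · exact List.pairwise_ofFn.2 fun i j hij => he hij
    · exact List.nodup_range.filter _
    · exact List.nodup_ofFn.2 he.injective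
    · intro i
      rw [List.mem_filter, List.mem_range, List.mem_ofFn]
      simp only [ne_eq, decide_eq_true_eq]
      constructor
      · rintro ⟨-, h2⟩
        by_contra hc
        exact h2 (Finsupp.mapDomain_of_notMem_range _ _ (by simpa using hc))
      · rintro ⟨j, rfl⟩
        refine ⟨hN j, ?_⟩
        rw [Finsupp.mapDomain_apply he.injective]
        exact hb j
  rw [h, List.map_ofFn]
  congr 1
  funext i
  exact Finsupp.mapDomain_apply he.injective _ _

/-- The monomial quasi-symmetric polynomials satisfy the recursion of `qs`. Both sides have the same
coefficients: a monomial occurs in `p^c` if and only if its non-zero exponents are the parts of `c`,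
in this order. -/
theorem rename_qsym {k : ℕ} (c : Composition k) (N : ℕ) :
    rename ((↑) : Fin N → ℕ) (qsym R c N) = qs R N c.blocks.reverse := by
  classical
  ext a
  by_cases ha : ↑a.support ⊆ Set.Iio N
  · obtain ⟨b, rfl⟩ : ∃ b : Fin N →₀ ℕ, a = b.mapDomain (↑) := by
      refine ⟨a.comapDomain (↑) Fin.val_injective.injOn, ?_⟩
      rw [Finsupp.mapDomain_comapDomain _ Fin.val_injective]
      intro i hi
      exact ⟨⟨i, ha hi⟩, rfl⟩
    obtain ⟨s, hs⟩ : ∃ s, ∑ i, b i = s := ⟨_, rfl⟩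
    obtain ⟨d, e, he, hb⟩ := exists_composition b hs
    have hL : expList (b.mapDomain ((↑) : Fin N → ℕ)) N = d.blocks.reverse := by
      have h1 : b.mapDomain ((↑) : Fin N → ℕ) =
          (Finsupp.equivFunOnFinite.symm d.blocksFun : Fin d.length →₀ ℕ).mapDomain
            fun i => (e i : ℕ) := by
        conv_lhs => rw [hb, ← Finsupp.mapDomain_comp]
        rfl
      rw [h1, expList_mapDomain (fun i j hij => he hij) (fun i => (e i).2)
        fun i => (Nat.pos_iff_ne_zero.1 (d.one_le_blocksFun i))]
      congr 1
      exact d.ofFn_blocksFun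
    rw [coeff_rename_mapDomain _ Fin.val_injective, coeff_qs N
      (fun e he => c.blocks_pos (List.mem_reverse.1 he)) ha, hL]
    by_cases hk : s = k
    · subst hk
      rw [hb, ← coeff_killCompl he.injective, qsym_killCompl c he, coeff_qsym_blocksFun]
      refine if_congr ?_ rfl rfl
      rw [List.reverse_inj, Composition.ext_iff, eq_comm]
    · rw [(qsym_isHomogeneous c N).coeff_eq_zero (by rwa [Finsupp.degree_eq_sum, hs]), if_neg]
      intro h
      apply hk
      rw [← d.blocks_sum, List.reverse_injective h, c.blocks_sum]
  · have h1 : coeff a (qs R N c.blocks.reverse) = 0 := by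
      by_contra hc
      exact ha (mem_lowDeg.1 (qs_mem_lowDeg N _) a (mem_support_iff.2 hc)).1
    rw [h1]
    refine coeff_rename_eq_zero _ _ _ fun u hu => ?_
    exfalso
    apply ha
    rw [← hu]
    intro i hi
    obtain ⟨x, -, rfl⟩ := Finset.mem_image.1 (Finsupp.mapDomain_support (Finset.mem_coe.1 hi))
    exact x.2

end QuasiSymmetric

/-! ### Runs of consecutive generators -/

section Runs

/-- The lengths of the maximal runs of consecutive numbers in the sequence `f 0, …, f (k - 1)`, in
reverse order. -/
def runs (f : ℕ → ℕ) : ℕ → List ℕ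
  | 0 => []
  | k + 1 => if 0 < k ∧ f k = f (k - 1) + 1 then (runs f k).modifyHead (· + 1) else 1 :: runs f k

theorem runs_pos {f : ℕ → ℕ} {k e : ℕ} (h : e ∈ runs f k) : 0 < e := by
  induction k generalizing e with
  | zero => simp [runs] at h
  | succ k ih =>
    rw [runs] at h
    split_ifs at h
    · revert h ih
      cases runs f k with
      | nil => simp
      | cons s l =>
        intro ih h
        rw [List.modifyHead_cons, List.mem_cons] at h
        rcases h with rfl | h
        · omega
        · exact ih (List.mem_cons_of_mem _ h)
    · rcases List.mem_cons.1 h with rfl | h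
      · exact one_pos
      · exact ih h

theorem runs_of_succ_eq_one_cons {f : ℕ → ℕ} {k : ℕ} {l : List ℕ} (h : runs f (k + 2) = 1 :: l) :
    runs f (k + 1) = l ∧ f (k + 1) ≠ f k + 1 := by
  rw [runs] at h
  split_ifs at h with hc
  · exfalso
    have h1 := fun e => runs_pos (f := f) (k := k + 1) (e := e)
    revert h h1
    cases runs f (k + 1) with
    | nil => simp
    | cons s l' =>
      intro h h1
      have h2 := h1 s List.mem_cons_self
      simp at h
      omega
  · exact ⟨(List.cons.inj h).2, fun h' => hc ⟨k.succ_pos, h'⟩⟩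

theorem runs_of_succ_eq_cons {f : ℕ → ℕ} {k e : ℕ} {l : List ℕ}
    (h : runs f (k + 2) = (e + 2) :: l) :
    runs f (k + 1) = (e + 1) :: l ∧ f (k + 1) = f k + 1 := by
  rw [runs] at h
  split_ifs at h with hc
  · refine ⟨?_, hc.2⟩
    revert h
    cases runs f (k + 1) <;> simp
  · exact absurd (List.cons.inj h).1 (by omega)

theorem sum_drop_le (l : List ℕ) (j : ℕ) : (l.drop j).sum ≤ l.sum := by
  conv_rhs => rw [← List.take_append_drop j l, List.sum_append]
  exact Nat.le_add_left _ _

/-- The runs are determined by the places at which a new run starts. -/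
theorem runs_eq {f : ℕ → ℕ} {k : ℕ} {l : List ℕ} (hl : ∀ e ∈ l, 0 < e) (hs : l.sum = k)
    (h : ∀ x, 0 < x → x < k → ((∃ j, (l.drop j).sum = x) ↔ f x ≠ f (x - 1) + 1)) :
    runs f k = l := by
  induction k generalizing l with
  | zero =>
    cases l with
    | nil => rfl
    | cons s l =>
      have := hl s List.mem_cons_self
      rw [List.sum_cons] at hs
      omega
  | succ k ih =>
    cases l with
    | nil => simp at hs
    | cons s l =>
      rw [List.sum_cons] at hs
      have hl' : ∀ e ∈ l, 0 < e := fun e he => hl e (List.mem_cons_of_mem _ he)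
      have hle := sum_drop_le l
      obtain _ | _ | s := s
      · exact absurd (hl 0 List.mem_cons_self) (lt_irrefl _)
      · rw [runs, if_neg, ih hl' (by omega)]
        · intro x hx hxk
          rw [← h x hx (by omega)]
          constructor
          · rintro ⟨j, hj⟩
            exact ⟨j + 1, hj⟩
          · rintro ⟨_ | j, hj⟩
            · simp at hj
              omega
            · exact ⟨j, hj⟩
        · rintro ⟨h1, h2⟩
          refine (h k h1 (by omega)).1 ⟨1, ?_⟩ h2
          rw [List.drop_succ_cons, List.drop_zero]
          omega
      · have e : runs f k = (s + 1) :: l := by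
          refine ih (fun e he => ?_) (by rw [List.sum_cons]; omega) fun x hx hxk => ?_
          · rcases List.mem_cons.1 he with rfl | he
            · exact s.succ_pos
            · exact hl' e he
          · rw [← h x hx (by omega)]
            constructor
            · rintro ⟨_ | j, hj⟩
              · simp at hj
                omega
              · exact ⟨j + 1, hj⟩
            · rintro ⟨_ | j, hj⟩
              · simp at hj
                omega
              · exact ⟨j + 1, hj⟩
        rw [runs, if_pos, e, List.modifyHead_cons]
        refine ⟨by omega, ?_⟩
        by_contra hc
        obtain ⟨_ | j, hj⟩ := (h k (by omega) (by omega)).2 hc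
        · simp at hj
          omega
        · have := hle j
          rw [List.drop_succ_cons] at hj
          omega

end Runs

/-! ### Increasing elements and their shape -/

section Shape

variable {n : ℕ}

theorem simpleRefl_commute {i j : Fin (n - 1)} (h : (i : ℕ) + 1 < j) :
    Commute (simpleRefl n i) (simpleRefl n j) := by
  rw [Commute, SemiconjBy]
  ext x
  simp only [Perm.mul_apply, simpleRefl_apply]
  split_ifs <;> omega

theorem not_simpleRefl_commute {i j : Fin (n - 1)} (h : (j : ℕ) = i + 1) :
    ¬ Commute (simpleRefl n i) (simpleRefl n j) := by
  intro hc
  have h1 := congrArg (fun w : Perm (Fin n) => ((w (lo i) : Fin n) : ℕ)) hc.eq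
  simp only [Perm.mul_apply, simpleRefl_apply] at h1
  split_ifs at h1 <;> omega

/-- A part of a composition ends before `x` if and only if `x` is not equivalent to its predecessor.
-/
theorem exists_sizeUpTo_iff {k : ℕ} (c : Composition k) {x : ℕ} (hx : 0 < x) (hxk : x < k) :
    (∃ j, c.sizeUpTo j = x) ↔ ¬ compLE c ⟨x, hxk⟩ ⟨x - 1, by omega⟩ := by
  set z : Fin k := ⟨x, hxk⟩ with hz
  set y : Fin k := ⟨x - 1, by omega⟩ with hy
  have z1 := c.sizeUpTo_index_le z
  have z2 : (z : ℕ) < c.sizeUpTo ((c.index z : ℕ) + 1) := c.lt_sizeUpTo_index_succ z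
  have y1 := c.sizeUpTo_index_le y
  have y2 : (y : ℕ) < c.sizeUpTo ((c.index y : ℕ) + 1) := c.lt_sizeUpTo_index_succ y
  simp only [hz, hy] at z1 z2 y1 y2
  rw [← hz, ← hy] at *
  rw [compLE, not_le, Fin.lt_def]
  constructor
  · rintro ⟨j, hj⟩
    by_contra hc
    rcases Nat.lt_or_ge (c.index z) j with h | h
    · have := c.monotone_sizeUpTo (show (c.index z : ℕ) + 1 ≤ j from h)
      omega
    · have := c.monotone_sizeUpTo (show j ≤ (c.index y : ℕ) by omega)
      omega
  · intro h
    refine ⟨_, le_antisymm z1 ?_⟩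
    have := c.monotone_sizeUpTo (show (c.index y : ℕ) + 1 ≤ c.index z from h)
    omega

theorem exists_sum_drop_iff {k : ℕ} (c : Composition k) {x : ℕ} :
    (∃ j, (c.blocks.reverse.drop j).sum = x) ↔ ∃ j, c.sizeUpTo j = x := by
  constructor
  · rintro ⟨j, rfl⟩
    refine ⟨c.blocks.length - j, ?_⟩
    rw [List.drop_reverse, List.sum_reverse, Composition.sizeUpTo]
  · rintro ⟨j, rfl⟩
    refine ⟨c.blocks.length - j, ?_⟩
    rw [List.drop_reverse, List.sum_reverse, Composition.sizeUpTo]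
    rcases le_total j c.blocks.length with h | h
    · rw [Nat.sub_sub_self h]
    · rw [List.take_of_length_le h, List.take_of_length_le (by omega)]

/-- The parts of the shape of an increasing element are the lengths of the runs of consecutive
generators. -/
theorem runs_eq_of_shape {k : ℕ} {c : Composition k} {i : Fin k → Fin (n - 1)} (hi : StrictMono i)
    (hc : ∀ x y, compLE c x y ↔ Relation.ReflTransGen
      (fun x y => x ≤ y ∨ ¬ Commute (simpleRefl n (i x)) (simpleRefl n (i y))) x y)
    {f : ℕ → ℕ} (hf : ∀ x : Fin k, f x = i x) : runs f k = c.blocks.reverse := by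
  refine runs_eq (fun e he => c.blocks_pos (List.mem_reverse.1 he))
    (by rw [List.sum_reverse, c.blocks_sum]) fun x hx hxk => ?_
  rw [exists_sum_drop_iff, exists_sizeUpTo_iff c hx hxk, not_iff_not, hc]
  have hx1 := hf ⟨x, hxk⟩
  have hx2 := hf ⟨x - 1, by omega⟩
  simp only at hx1 hx2
  rw [hx1, hx2]
  constructor
  · intro h
    by_contra hne
    have key : ∀ y : Fin k, Relation.ReflTransGen
        (fun x y => x ≤ y ∨ ¬ Commute (simpleRefl n (i x)) (simpleRefl n (i y))) ⟨x, hxk⟩ y →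
        x ≤ y := by
      intro y hy
      induction hy with
      | refl => exact le_rfl
      | tail _ hstep ih =>
        rename_i u v _
        rcases hstep with h' | h'
        · exact ih.trans h'
        · by_contra hlt
          apply h'
          refine (simpleRefl_commute ?_).symm
          have h1 : i v ≤ i ⟨x - 1, by omega⟩ := hi.monotone (Fin.le_def.2 (by simp only; omega))
          have h2 : i ⟨x, hxk⟩ ≤ i u := hi.monotone (Fin.le_def.2 ih)
          have h3 : i ⟨x - 1, by omega⟩ < i ⟨x, hxk⟩ := hi (Fin.lt_def.2 (by simp only; omega))
          rw [Fin.le_def] at h1 h2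
          rw [Fin.lt_def] at h3
          omega
    have := key _ h
    simp only at this
    omega
  · intro h
    exact Relation.ReflTransGen.single (Or.inr fun hcomm => not_simpleRefl_commute h hcomm.symm)

theorem FixesAbove.mul_simpleRefl {i : Fin (n - 1)} {j : ℕ} {w : Perm (Fin n)}
    (h : FixesAbove j w) (hi : (i : ℕ) < j) : FixesAbove j (w * simpleRefl n i) := by
  intro x hx
  have : simpleRefl n i x = x := by
    ext
    rw [simpleRefl_apply]
    split_ifs <;> omega
  rw [Perm.mul_apply, this, h x hx]

theorem T_prod_ofFn {R : Type*} [CommRing R] (q : Rˣ) {k : ℕ} {i : Fin k → Fin (n - 1)}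
    (hi : StrictMono i) {f : ℕ → ℕ} (hf : ∀ x : Fin k, f x = i x) :
    T q (List.ofFn fun x => simpleRefl n (i x)).prod = genWord R q n f k := by
  have hfix : ∀ {k : ℕ} (i : Fin k → Fin (n - 1)) (m : ℕ), (∀ x, (i x : ℕ) < m) →
      FixesAbove m (List.ofFn fun x => simpleRefl n (i x)).prod := by
    intro k i m hm
    induction k with
    | zero =>
      intro x _
      simp
    | succ k ih =>
      rw [List.ofFn_succ', List.concat_eq_append, List.prod_append, List.prod_singleton]
      exact (ih _ fun x => hm x.castSucc).mul_simpleRefl (hm _)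
  induction k with
  | zero => simp [genWord, T_one]
  | succ k ih =>
    have hl := hf (Fin.last k)
    rw [Fin.val_last] at hl
    rw [List.ofFn_succ', List.concat_eq_append, List.prod_append, List.prod_singleton, genWord,
      ← ih (i := fun x => i x.castSucc) (fun x y h => hi (Fin.castSucc_lt_castSucc_iff.2 h))
        fun x => hf x.castSucc, hl, gen_of_lt q (i (Fin.last k)).2, T_mul_simpleRefl_of_asc]
    have h1 := hfix (fun x : Fin k => i x.castSucc) (i (Fin.last k))
      fun x => hi (Fin.castSucc_lt_last x)
    rw [Asc, inv_inv, h1 (HeckeJM.hi (i (Fin.last k))) (by simp), Fin.lt_def]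
    exact Nat.lt_succ_of_le (h1.le le_rfl)

end Shape

/-! ### Entries of the matrices -/

section Matrices

variable {R : Type*} [CommRing R] (q : Rˣ)

theorem compLT_ext {k : ℕ} {α β : CompLT k} (h : α.2.blocks = β.2.blocks) : α = β := by
  obtain ⟨⟨i, hi⟩, c⟩ := α
  obtain ⟨⟨j, hj⟩, d⟩ := β
  have hij : i = j := by
    have := c.blocks_sum
    rw [show c.blocks = d.blocks from h] at this
    exact this.symm.trans d.blocks_sum
  subst hij
  exact congrArg (Sigma.mk _) (Composition.ext h)

theorem compLT_sum {k : ℕ} (α : CompLT k) : α.2.blocks.sum = α.1 := α.2.blocks_sum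

theorem blocks_ne_nil {m : ℕ} (c : Composition m) (hm : 0 < m) : c.blocks ≠ [] := by
  intro h
  have := c.blocks_sum
  rw [h, List.sum_nil] at this
  omega

theorem prime_lt {m : ℕ} (c : Composition m) (hm : 0 < m) {k : ℕ} (hk : m ≤ k) :
    ((prime c hm hk).1 : ℕ) < m := by
  have h1 := congrArg List.sum (List.dropLast_append_getLast (blocks_ne_nil c hm))
  have h2 := c.blocks_pos (List.getLast_mem (blocks_ne_nil c hm))
  rw [List.sum_append, List.sum_singleton, c.blocks_sum] at h1
  show c.blocks.dropLast.sum < m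
  omega

theorem blocks_reverse_eq {m : ℕ} (c : Composition m) (hm : 0 < m) {k : ℕ} (hk : m ≤ k) :
    c.blocks.reverse = (m - (prime c hm hk).1) :: (prime c hm hk).2.blocks.reverse := by
  have h0 := List.dropLast_append_getLast (blocks_ne_nil c hm)
  have h1 := congrArg List.sum h0
  rw [List.sum_append, List.sum_singleton, c.blocks_sum] at h1
  have h2 : m - (prime c hm hk).1 = c.blocks.getLast (blocks_ne_nil c hm) := by
    show m - c.blocks.dropLast.sum = _
    omega
  rw [h2]
  conv_lhs => rw [← h0, List.reverse_append]
  rfl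

theorem mul_Zmat {k : ℕ} (M : Matrix (CompLT k) (CompLT k) R) (α δ : CompLT k) :
    (M * Zmat R k) α δ =
      M α δ + if h : 0 < (δ.1 : ℕ) then M α (prime δ.2 h δ.1.2.le) else 0 := by
  rw [Matrix.mul_apply]
  split_ifs with h
  · set δ' := prime δ.2 h δ.1.2.le with hδ'
    have hne : δ ≠ δ' := by
      intro hc
      have h1 := prime_lt δ.2 h δ.1.2.le
      rw [← hδ', ← hc] at h1
      exact lt_irrefl _ h1
    have hZ : ∀ γ, Zmat R k γ δ = (if γ = δ then 1 else 0) + if γ = δ' then 1 else 0 := by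
      intro γ
      have h1 : (δ.2.blocks ≠ [] ∧ γ.2.blocks = δ.2.blocks.dropLast) ↔ γ = δ' := by
        constructor
        · exact fun h2 => compLT_ext h2.2
        · rintro rfl
          exact ⟨blocks_ne_nil _ h, rfl⟩
      rw [Zmat, Matrix.of_apply]
      simp only [h1]
      by_cases h2 : γ = δ
      · rw [if_pos (Or.inl h2), if_pos h2, if_neg (by rw [h2]; exact hne), add_zero]
      · simp [h2]
    simp [hZ, mul_add, Finset.sum_add_distrib]
  · have hZ : ∀ γ, Zmat R k γ δ = if γ = δ then 1 else 0 := by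
      intro γ
      have h1 : ¬ (δ.2.blocks ≠ [] ∧ γ.2.blocks = δ.2.blocks.dropLast) := by
        rintro ⟨h2, -⟩
        obtain ⟨e, he⟩ := List.exists_mem_of_ne_nil _ h2
        have h3 := δ.2.blocks_pos he
        have h4 := List.single_le_sum (fun _ _ => Nat.zero_le _) e he
        rw [compLT_sum] at h4
        omega
      rw [Zmat, Matrix.of_apply]
      simp only [h1, or_false]
    simp [hZ]

/-- A composition of size less than `k + 1` as a composition of size less than `k`. -/
def cut {k : ℕ} (α : CompLT (k + 1)) (h : (α.1 : ℕ) < k) : CompLT k := ⟨⟨α.1, h⟩, α.2⟩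

variable {k : ℕ} (hk : 0 < k) (M : Matrix (CompLT k) (CompLT k) R) {α β : CompLT (k + 1)}

theorem blockDiag_lt_lt (hα : (α.1 : ℕ) < k) (hβ : (β.1 : ℕ) < k) :
    blockDiag k hk M α β = M (cut α hα) (cut β hβ) := by
  simp only [blockDiag, Matrix.submatrix_apply, split, dif_pos hα, dif_pos hβ]
  rfl

theorem blockDiag_lt_not (hα : (α.1 : ℕ) < k) (hβ : ¬ (β.1 : ℕ) < k) :
    blockDiag k hk M α β = 0 := by
  simp [blockDiag, split, dif_pos hα, dif_neg hβ]

theorem blockDiag_not_lt (hα : ¬ (α.1 : ℕ) < k) (hβ : (β.1 : ℕ) < k) :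
    blockDiag k hk M α β = 0 := by
  simp [blockDiag, split, dif_neg hα, dif_pos hβ]

theorem blockDiag_not_not (hα : ¬ (α.1 : ℕ) < k) (hβ : ¬ (β.1 : ℕ) < k) :
    blockDiag k hk M α β =
      M (prime α.2 (by omega) (by omega)) (prime β.2 (by omega) (by omega)) := by
  simp only [blockDiag, Matrix.submatrix_apply, split, dif_neg hα, dif_neg hβ]
  rfl

end Matrices

/-! ### The recursion for the pairings -/

section Recursion

variable {R : Type*} [CommRing R] (q : Rˣ) {n : ℕ}

theorem coeff_aS_mul_qs (N : ℕ) {l k : ℕ} (h : l ≤ k) (μ : Composition l) :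
    PowerSeries.coeff (k - l) (aS q N) * qs R N μ.blocks.reverse =
      ∑ ν : Composition k, aMul q ν μ • qs R N ν.blocks.reverse := by
  have := congrArg (rename ((↑) : Fin N → ℕ)) (aPoly_mul_qsym q h μ N)
  simpa only [map_mul, map_sum, map_smul, rename_qsym, ← coeff_aS] using this

/-- The expansion of the quasi-symmetric polynomials that defines the matrix `A`. -/
theorem qs_mul_coeff_aS_mul_geo (k j : ℕ) (β : CompLT (k + 1)) :
    qs R (j + 1) β.2.blocks.reverse *
        PowerSeries.coeff (k - β.1) (aS q (j + 1) * geo (X j)) =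
      ∑ δ : CompLT (k + 1), aMul q δ.2 β.2 •
        (qs R (j + 1) δ.2.blocks.reverse * X j ^ (k - (δ.1 : ℕ))) := by
  obtain ⟨⟨b, hb⟩, β⟩ := β
  obtain ⟨r, rfl⟩ := Nat.exists_eq_add_of_le (Nat.lt_succ_iff.1 hb)
  let F : ℕ → MvPolynomial ℕ R := fun i => if b ≤ i then
    PowerSeries.coeff (i - b) (aS q (j + 1)) * qs R (j + 1) β.blocks.reverse * X j ^ (b + r - i)
      else 0
  have inner : ∀ i : ℕ, ∑ ν : Composition i, aMul q ν β •
      (qs R (j + 1) ν.blocks.reverse * X j ^ (b + r - i)) = F i := by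
    intro i
    simp only [F]
    split_ifs with h
    · rw [coeff_aS_mul_qs q _ h, Finset.sum_mul]
      simp only [smul_mul_assoc]
    · refine Finset.sum_eq_zero fun ν _ => ?_
      rw [aMul, if_neg h, zero_smul]
  rw [Fintype.sum_sigma]
  simp only [inner]
  rw [(Fin.sum_univ_eq_sum_range F (b + r + 1)).trans (Finset.sum_range_add F b (r + 1)),
    Finset.sum_eq_zero fun i hi => if_neg (not_le.2 (Finset.mem_range.1 hi)), zero_add,
    Nat.add_sub_cancel_left, PowerSeries.coeff_mul,
    Finset.Nat.sum_antidiagonal_eq_sum_range_succ_mk, Finset.mul_sum]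
  refine Finset.sum_congr rfl fun i _ => ?_
  simp only [F]
  rw [if_pos (Nat.le_add_right b i), Nat.add_sub_cancel_left, geo, PowerSeries.coeff_mk,
    Nat.add_sub_add_left]
  ring

/-- The pairing with a quasi-symmetric polynomial does not change if variables are added beyond the
first one that involves the last letter of the word. -/
theorem pairing_qs_eq_of_le {f : ℕ → ℕ} {k m : ℕ} (hf : StrictMonoOn f (Set.Iio k))
    (hn : ∀ x < k, f x < n - 1) (hm : ∀ x < k, f x + 2 ≤ m) {l : List ℕ} (hl : ∀ e ∈ l, 0 < e)
    (hs : l.sum ≤ k) (hm0 : 0 < m) {M : ℕ} (hM : m ≤ M) :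
    pairing R q n f k (qs R M l) = pairing R q n f k (qs R m l) := by
  induction M, hM using Nat.le_induction with
  | base => rfl
  | succ M hM ih =>
    cases l with
    | nil => rw [qs_nil, qs_nil]
    | cons e l =>
      rw [qs_succ_cons, map_add, ih]
      obtain ⟨e, rfl⟩ : ∃ s, e = s + 1 := ⟨e - 1, by have := hl e List.mem_cons_self; omega⟩
      obtain ⟨M, rfl⟩ : ∃ s, M = s + 1 := ⟨M - 1, by omega⟩
      rw [List.sum_cons] at hs
      rw [pairing_mul_X_pow_eq_zero q hf hn (fun x hx => by have := hm x hx; omega)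
        (qs_mem_lowDeg (M + 1) l) (by omega), add_zero]

theorem pairing_qs_mul_X_pow_eq_zero {f : ℕ → ℕ} {k j e : ℕ} (hf : StrictMonoOn f (Set.Iio k))
    (hn : ∀ x < k, f x < n - 1) (hj : ∀ x < k, f x < j) {l : List ℕ} (hs : l.sum + e + 1 ≤ k) :
    pairing R q n f k (qs R (j + 2) l * X (j + 1) ^ (e + 1)) = 0 := by
  cases l with
  | nil =>
    rw [qs_nil]
    exact pairing_mul_X_pow_eq_zero q hf hn hj (one_mem_lowDeg _ 0) (by omega)
  | cons s l =>
    rw [List.sum_cons] at hs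
    rw [qs_succ_cons, add_mul, map_add, mul_assoc, ← pow_add, ← add_assoc,
      pairing_mul_X_pow_eq_zero q hf hn hj (qs_mem_lowDeg _ _) (by rw [List.sum_cons]; omega),
      pairing_mul_X_pow_eq_zero q hf hn hj (qs_mem_lowDeg _ _) (by omega), add_zero]

theorem coeff_zero_aS (N : ℕ) : PowerSeries.coeff 0 (aS q N) = 1 := by
  rw [PowerSeries.coeff_zero_eq_constantCoeff_apply, aS, map_prod]
  refine Finset.prod_eq_one fun i _ => ?_
  rw [← PowerSeries.coeff_zero_eq_constantCoeff_apply, alphaS, PowerSeries.coeff_mk]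
  simp [aCoeff]

/-- The pairing of an increasing word of length `k + 1` is expressed by pairings of the word of
length `k` without the last letter. -/
theorem pairing_qs_succ {f : ℕ → ℕ} {k M : ℕ} (hf : StrictMonoOn f (Set.Iio (k + 1)))
    (hn : ∀ x < k + 1, f x < n - 1) (hM : f k + 2 ≤ M) (β : CompLT (k + 1)) :
    pairing R q n f (k + 1) (qs R M ((k + 1 - β.1) :: β.2.blocks.reverse)) =
      pairing R q n f k (qs R (f k + 1) β.2.blocks.reverse *
        PowerSeries.coeff (k - β.1) (aS q (f k + 1) * geo (X (f k)))) := by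
  have hf' : ∀ x < k, f x < f k := fun x hx =>
    hf (show x < k + 1 by omega) (show k < k + 1 by omega) hx
  have hb := β.1.2
  have hsum := compLT_sum β
  have h1 : ∀ x < k + 1, f x + 2 ≤ f k + 2 := by
    intro x hx
    rcases Nat.lt_succ_iff_lt_or_eq.1 hx with h | rfl
    · have := hf' x h
      omega
    · exact le_rfl
  have h2 : ∀ e ∈ (k + 1 - (β.1 : ℕ)) :: β.2.blocks.reverse, 0 < e := by
    intro e he
    rcases List.mem_cons.1 he with rfl | he
    · omega
    · exact β.2.blocks_pos (List.mem_reverse.1 he)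
  have h3 : ((k + 1 - (β.1 : ℕ)) :: β.2.blocks.reverse).sum ≤ k + 1 := by
    rw [List.sum_cons, List.sum_reverse, hsum]
    omega
  have h4 : β.2.blocks.reverse.sum + (k - (β.1 : ℕ)) ≤ k := by
    rw [List.sum_reverse, hsum]
    omega
  rw [pairing_qs_eq_of_le q hf hn h1 h2 h3 (by omega) hM, qs_succ_cons, map_add,
    pairing_succ_eq_zero q hf' (qs_mem_lowDeg _ _), zero_add,
    show k + 1 - (β.1 : ℕ) = k - β.1 + 1 by omega,
    pairing_succ_mul_X_pow_succ q hf hn (qs_mem_lowDeg _ _) h4]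

/-- The pairings of increasing words with quasi-symmetric polynomials satisfy the recursion that
defines the matrices `Ξ`. A composition of `k + 1` is represented by the composition without its
last part, of size less than `k + 1`, so that its last part is the number missing from `k + 1`. -/
theorem pairing_qs_eq_XiMat {f : ℕ → ℕ} {k : ℕ} (hf : StrictMonoOn f (Set.Iio (k + 1)))
    (hn : ∀ x < k + 1, f x < n - 1) (α β : CompLT (k + 1))
    (hα : runs f (k + 1) = (k + 1 - α.1) :: α.2.blocks.reverse) {M : ℕ} (hM : f k + 2 ≤ M) :
    pairing R q n f (k + 1) (qs R M ((k + 1 - β.1) :: β.2.blocks.reverse)) =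
      XiMat q (k + 1) α β := by
  rw [pairing_qs_succ q hf hn hM]
  induction k generalizing M with
  | zero =>
    -- The only composition of size less than one is the empty one.
    have hnil : ∀ γ : CompLT 1, γ.2.blocks = [] := by
      intro γ
      by_contra hc
      obtain ⟨e, he⟩ := List.exists_mem_of_ne_nil _ hc
      have h3 := γ.2.blocks_pos he
      have h4 := List.single_le_sum (fun _ _ => Nat.zero_le _) e he
      have h5 := γ.1.2
      rw [compLT_sum] at h4
      omega
    have hαβ : α = β := compLT_ext ((hnil α).trans (hnil β).symm)
    have h0 : 0 - (β.1 : ℕ) = 0 := by omega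
    have h1 : PowerSeries.coeff 0 (aS q (f 0 + 1) * geo (X (f 0))) = 1 := by
      rw [PowerSeries.coeff_zero_eq_constantCoeff_apply, map_mul,
        ← PowerSeries.coeff_zero_eq_constantCoeff_apply, coeff_zero_aS,
        ← PowerSeries.coeff_zero_eq_constantCoeff_apply, geo, PowerSeries.coeff_mk, pow_zero,
        mul_one]
    rw [hαβ, hnil β, List.reverse_nil, qs_nil, one_mul, h0, h1, pairing_apply, map_one, one_mul,
      genWord, ← T_one q, traceLin_T, if_pos rfl]
    exact (Matrix.one_apply_eq β).symm
  | succ k ih =>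
    have hfk : StrictMonoOn f (Set.Iio (k + 1)) := hf.mono (Set.Iio_subset_Iio (by omega))
    have hnk : ∀ x < k + 1, f x < n - 1 := fun x hx => hn x (by omega)
    have hlt : f k < f (k + 1) := hf (show k < k + 2 by omega) (show k + 1 < k + 2 by omega)
      k.lt_succ_self
    have hle : ∀ x < k + 1, f x ≤ f k := fun x hx =>
      hfk.monotoneOn (show x < k + 1 from hx) (show k < k + 1 by omega) (by omega)
    have hle' : ∀ x < k, f x < f k := fun x hx =>
      hf (show x < k + 2 by omega) (show k < k + 2 by omega) hx
    have ih := fun (α β : CompLT (k + 1)) (h : runs f (k + 1) = _) (M : ℕ) (hM : f k + 2 ≤ M) =>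
      (pairing_qs_succ q hfk hnk hM β).trans (ih hfk hnk α β h hM)
    rw [qs_mul_coeff_aS_mul_geo, map_sum, XiMat, Matrix.mul_apply]
    refine Finset.sum_congr rfl fun δ _ => ?_
    rw [map_smul, smul_eq_mul, mul_comm, Amat, Matrix.of_apply]
    congr 1
    rw [mul_Zmat]
    have hα1 := α.1.2
    have hδ1 := δ.1.2
    obtain ⟨j, hj⟩ : ∃ j, f (k + 1) = j + 1 := ⟨f (k + 1) - 1, by omega⟩
    rw [hj] at hlt ⊢
    by_cases ha : (α.1 : ℕ) < k + 1
    -- The last part of the shape is at least two, so the last two letters are adjacent.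
    · obtain ⟨hα', hjk⟩ := runs_of_succ_eq_cons (e := k - α.1)
        (hα.trans (by congr 1; omega))
      have hjk' : j = f k := by omega
      subst hjk'
      have ihα := fun β => ih (cut α ha) β (hα'.trans (by
        change _ = (k + 1 - (α.1 : ℕ)) :: _
        congr 1
        omega)) (f k + 2) le_rfl
      -- The letter `g_{f k}` is matched only by monomials with last variable `X_{f k + 1}`.
      have vanish : ∀ l s, pairing R q n f (k + 1) (qs R (f k + 1) l * X (f k + 1) ^ s) =
          pairing R q n f (k + 1) (qs R (f k + 2) (s :: l)) := by
        intro l s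
        rw [qs_succ_cons, map_add, pairing_succ_eq_zero q hle' (qs_mem_lowDeg _ _), zero_add]
      by_cases hd : (δ.1 : ℕ) < k + 1
      · rw [blockDiag_lt_lt _ _ ha hd]
        have hcut := ihα (cut δ hd)
        change pairing R q n f (k + 1) (qs R (f k + 2) ((k + 1 - (δ.1 : ℕ)) ::
          δ.2.blocks.reverse)) = _ at hcut
        by_cases h0 : 0 < (δ.1 : ℕ)
        · rw [dif_pos h0, blockDiag_lt_lt _ _ ha ((prime_lt _ _ _).trans hd)]
          have hpl := prime_lt δ.2 h0 δ.1.2.le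
          have hcut' := ihα (cut (prime δ.2 h0 δ.1.2.le) (hpl.trans hd))
          change pairing R q n f (k + 1) (qs R (f k + 2)
            ((k + 1 - ((prime δ.2 h0 δ.1.2.le).1 : ℕ)) ::
              (prime δ.2 h0 δ.1.2.le).2.blocks.reverse)) = _ at hcut'
          rw [← vanish] at hcut hcut'
          rw [← hcut, ← hcut', blocks_reverse_eq δ.2 h0 δ.1.2.le]
          rw [qs_succ_cons (f k + 1), add_mul, map_add, mul_assoc, ← pow_add]
          congr 4
          omega
        · have hnil : δ.2.blocks.reverse = [] := by
            have h1 := compLT_sum δ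
            rw [List.reverse_eq_nil_iff]
            by_contra hc
            obtain ⟨e, he⟩ := List.exists_mem_of_ne_nil _ hc
            have h3 := δ.2.blocks_pos he
            have h4 := List.single_le_sum (fun _ _ => Nat.zero_le _) e he
            omega
          rw [dif_neg h0, add_zero, ← hcut, ← vanish, hnil, qs_nil, qs_nil]
      · have h0 : 0 < (δ.1 : ℕ) := by omega
        have hdk : (δ.1 : ℕ) = k + 1 := by omega
        have hpl := prime_lt δ.2 h0 δ.1.2.le
        rw [blockDiag_lt_not _ _ ha hd, zero_add, dif_pos h0,
          blockDiag_lt_lt _ _ ha (by omega), ← ihα, show k + 1 - (δ.1 : ℕ) = 0 by omega, pow_zero,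
          mul_one, blocks_reverse_eq δ.2 h0 δ.1.2.le]
        congr 3
        change (δ.1 : ℕ) - ((prime δ.2 h0 δ.1.2.le).1 : ℕ) =
          k + 1 - ((prime δ.2 h0 δ.1.2.le).1 : ℕ)
        omega
    -- The last part of the shape is one, so the last letter is not adjacent to the others. Then
    -- powers of the last variable do not contribute, since it is beyond the letters that remain.
    · have hak : (α.1 : ℕ) = k + 1 := by omega
      obtain ⟨hα', hjk⟩ := runs_of_succ_eq_one_cons (hα.trans (by congr 1; omega))
      by_cases hd : (δ.1 : ℕ) < k + 1
      · have hz := compLT_sum δ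
        rw [blockDiag_not_lt _ _ ha hd, zero_add,
          show k + 1 - (δ.1 : ℕ) = k - δ.1 + 1 by omega,
          pairing_qs_mul_X_pow_eq_zero q hfk hnk (fun x hx => by have := hle x hx; omega)
            (by rw [List.sum_reverse, hz]; omega)]
        split_ifs with h0
        · rw [blockDiag_not_lt _ _ ha ((prime_lt _ _ _).trans hd)]
        · rfl
      · have h0 : 0 < (δ.1 : ℕ) := by omega
        have hpl := prime_lt δ.2 h0 δ.1.2.le
        rw [blockDiag_not_not _ _ ha hd, dif_pos h0,
          blockDiag_not_lt _ _ ha (show ((prime δ.2 h0 δ.1.2.le).1 : ℕ) < k + 1 by omega), add_zero,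
          show k + 1 - (δ.1 : ℕ) = 0 by omega, pow_zero, mul_one]
        have hd' : (δ.1 : ℕ) ≤ k + 1 := by omega
        have ha' : (α.1 : ℕ) ≤ k + 1 := by omega
        have h1 := blocks_reverse_eq δ.2 h0 hd'
        have h2 := blocks_reverse_eq α.2 (show 0 < (α.1 : ℕ) by omega) ha'
        rw [h1, ← ih _ _ (hα'.trans (h2.trans (by congr 1; omega))) (j + 2) (by omega)]
        congr 3
        omega

end Recursion

end HeckeJM

theorem mainTheorem3 {R : Type*} [CommRing R] (q : Rˣ) (n k : ℕ) (hk : 0 < k)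
    (c d : Composition k) (w : Equiv.Perm (Fin n)) (hw : HeckeJM.IsIncreasingOfShape w c) :
    HeckeJM.heckeForm q (HeckeJM.T q w)
        (HeckeJM.evalAt (HeckeJM.jucysMurphy R q n) (HeckeJM.qsym R d n)) =
      HeckeJM.XiMat q k (HeckeJM.prime c hk le_rfl) (HeckeJM.prime d hk le_rfl) := by
  obtain ⟨i, hi, rfl, hc⟩ := hw
  obtain ⟨k, rfl⟩ : ∃ m, k = m + 1 := ⟨k - 1, by omega⟩
  set f : ℕ → ℕ := fun x => if h : x < k + 1 then i ⟨x, h⟩ else 0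
  have hfx : ∀ x (h : x < k + 1), f x = i ⟨x, h⟩ := fun x h => dif_pos h
  have hf : ∀ x : Fin (k + 1), f x = i x := fun x => hfx x x.2
  have hn : ∀ x < k + 1, f x < n - 1 := fun x hx => by
    rw [hfx x hx]
    exact (i _).2
  have hmono : StrictMonoOn f (Set.Iio (k + 1)) := by
    intro x hx y hy hxy
    rw [hfx x hx, hfx y hy]
    exact hi (show (⟨x, hx⟩ : Fin (k + 1)) < ⟨y, hy⟩ from hxy)
  have hruns := (HeckeJM.runs_eq_of_shape hi hc hf).trans (HeckeJM.blocks_reverse_eq c hk le_rfl)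
  have hfk := hn k (by omega)
  rw [← HeckeJM.pairing_qs_eq_XiMat q hmono hn _ (HeckeJM.prime d hk le_rfl) hruns
      (show f k + 2 ≤ n by omega),
    HeckeJM.heckeForm, HeckeJM.evalAt_jucysMurphy, HeckeJM.rename_qsym,
    HeckeJM.T_prod_ofFn q hi hf, HeckeJM.blocks_reverse_eq d hk le_rfl]
  rfl
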